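/- Let $\mathbb K$ be a field and let $G$ be a finite simple graph with vertex set $V(G)=\{x_1,\dots,x_n\}$ and edge set $E(G)$. Let $S=\mathbb K[x_1,\dots,x_n]$ with its standard grading, and let $I(G)=(x_ix_j : x_ix_j\in E(G))\subseteq S$ be the edge ideal of $G$. For an ideal $I$ of $S$ and an integer $s\ge 1$, let $$I^{(s)}=\bigcap_{\mathfrak p\in \mathrm{Min}(I)}\mathrm{Ker}\big(S\to (S/I^s)_{\mathfrak p}\big)$$ be its $s$-th symbolic power, where $\mathrm{Min}(I)$ is the set of minimal primes of $I$. For a finitely generated graded $S$-module $M$ with minimal graded free resolution $$\cdots\to\bigoplus_j S(-j)^{\beta_{1,j}(M)}\to\bigoplus_j S(-j)^{\beta_{0,j}(M)}\to M\to 0,$$ let $\mathrm{reg}(M)=\max\{j-i : \beta_{i,j}(M)\ne 0\}$ be its Castelnuovo–Mumford regularity (with $\mathrm{reg}(0)=-\infty$). Then for every integer $s\ge 1$, $$\mathrm{reg}\big(I(G)^{(s+1)}\big)\le\max\Big\{\mathrm{reg}(I(G))+2s,\ \mathrm{reg}\big(I(G)^{(s+1)}+I(G)^s\big)\Big\}.$$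 -/

import Mathlib

noncomputable section

/-! Castelnuovo-Mumford regularity of finitely generated graded modules over the standard graded
polynomial ring `S = K[x_v : v ∈ V]`, with `V` finite. -/

/-- The degree `j` component `S_j` of the standard grading of `S`, for `j : ℤ`
(so it is zero for `j < 0`). -/
def polyComponent (K V : Type*) [Field K] (j : ℤ) : Submodule K (MvPolynomial V K) :=
  MvPolynomial.restrictSupport K {m : V →₀ ℕ | (m.degree : ℤ) = j}

/-- The degree `j` component of the graded free module `⨁ a, S(-e a)`: in the summand `S(-e a)`
the degree `j` component is `S_{j - e a}`, and the basis vector number `a` has degree `e a`. -/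
def freeComponent (K V : Type*) [Field K] {r : ℕ} (e : Fin r → ℤ) (j : ℤ) :
    Set (Fin r → MvPolynomial V K) :=
  {x | ∀ a, x a ∈ polyComponent K V (j - e a)}

/-- A minimal graded free resolution
`⋯ ⟶ F 2 ⟶ F 1 ⟶ F 0 ⟶ M ⟶ 0`, with `F i = ⨁ (a : Fin (rank i)), S(-shift i a)`, of a finitely
generated `S`-module `M` whose degree `j` component is `ℳ j`. -/
structure MinimalGradedFreeResolution (K V : Type*) [Field K] (M : Type*) [AddCommGroup M]
    [Module (MvPolynomial V K) M] [Module K M] (ℳ : ℤ → Submodule K M) where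
  /-- the rank of `F i` -/
  rank : ℕ → ℕ
  /-- the degrees of the basis vectors of `F i` -/
  shift : (i : ℕ) → Fin (rank i) → ℤ
  /-- the differential `F (i + 1) ⟶ F i` -/
  d : (i : ℕ) →
    (Fin (rank (i + 1)) → MvPolynomial V K) →ₗ[MvPolynomial V K] (Fin (rank i) → MvPolynomial V K)
  /-- the augmentation `F 0 ⟶ M` -/
  aug : (Fin (rank 0) → MvPolynomial V K) →ₗ[MvPolynomial V K] M
  /-- the differentials are homogeneous of degree `0` -/
  d_mem : ∀ i j, ∀ x ∈ freeComponent K V (shift (i + 1)) j, d i x ∈ freeComponent K V (shift i) j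
  /-- the augmentation is homogeneous of degree `0` -/
  aug_mem : ∀ j, ∀ x ∈ freeComponent K V (shift 0) j, aug x ∈ ℳ j
  aug_surjective : Function.Surjective aug
  exact_zero : Function.Exact (d 0) aug
  exact_succ : ∀ i, Function.Exact (d (i + 1)) (d i)
  /-- minimality: the image of `F (i + 1)` lies in `𝔪 F i`, where `𝔪` is the ideal of the
  polynomials without constant term -/
  minimal : ∀ i x a, MvPolynomial.constantCoeff (d i x a) = 0

/-- The graded Betti number `β_{i,j}` read off from a minimal graded free resolution: the number of
summands `S(-j)` in homological degree `i`. -/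
def MinimalGradedFreeResolution.betti {K V : Type*} [Field K] {M : Type*} [AddCommGroup M]
    [Module (MvPolynomial V K) M] [Module K M] {ℳ : ℤ → Submodule K M}
    (F : MinimalGradedFreeResolution K V M ℳ) (i : ℕ) (j : ℤ) : ℕ :=
  Fintype.card {a : Fin (F.rank i) // F.shift i a = j}

/-- The Castelnuovo-Mumford regularity `reg M = max {j - i | β_{i,j}(M) ≠ 0}` of a finitely
generated graded module. The Betti numbers do not depend on the minimal graded free resolution, so
nothing changes when the supremum is taken over all of them at once. The zero module has
regularity `-∞ = ⊥`. -/
def gradedRegularity (K V : Type*) [Field K] (M : Type*) [AddCommGroup M]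
    [Module (MvPolynomial V K) M] [Module K M] (ℳ : ℤ → Submodule K M) : EReal :=
  ⨆ (F : MinimalGradedFreeResolution K V M ℳ) (i : ℕ) (j : ℤ) (_ : F.betti i j ≠ 0),
    (((j - (i : ℤ) : ℤ) : ℝ) : EReal)

/-- The degree `j` component `I ∩ S_j` of a homogeneous ideal `I` of `S`. -/
def idealComponent {K V : Type*} [Field K] (I : Ideal (MvPolynomial V K)) (j : ℤ) :
    Submodule K I :=
  (polyComponent K V j).comap (I.subtype.restrictScalars K)

/-- The regularity of a homogeneous ideal of `S`, as a graded `S`-module. -/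
def idealRegularity {K V : Type*} [Field K] (I : Ideal (MvPolynomial V K)) : EReal :=
  gradedRegularity K V I (idealComponent I)

/-- The `s`-th symbolic power
`I^{(s)} = ⋂ 𝔭 ∈ Min(I), Ker (R → (R / I ^ s)_𝔭)`. -/
def symbolicPower {R : Type*} [CommRing R] (I : Ideal R) (s : ℕ) : Ideal R :=
  ⨅ (p : Ideal R) (hp : p ∈ I.minimalPrimes),
    haveI : p.IsPrime := hp.1.1
    LinearMap.ker
      ((LocalizedModule.mkLinearMap p.primeCompl (R ⧸ I ^ s)).comp (Submodule.mkQ (I ^ s)))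

/-- The edge ideal `I(G) = (x_v x_w : vw ∈ E(G))`. -/
def edgeIdeal (K : Type*) [Field K] {V : Type*} (G : SimpleGraph V) :
    Ideal (MvPolynomial V K) :=
  Ideal.span {f | ∃ v w, G.Adj v w ∧ f = MvPolynomial.X v * MvPolynomial.X w}

end

-- Let I = I(G). Adjoin the products of s edges to I^{(s+1)} one at a time, from the
-- lexicographically largest exponent to the smallest; the last ideal is I^{(s+1)} + I^s. If J is
-- one of these ideals and m is the next product, then J ∩ (m) = m (J : m), so by Mayer–Vietoris reg
-- J is at most the maximum of reg(J + (m)), reg(J : m) + 2s and 2s - 1. Descending from the last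
-- ideal to I^{(s+1)}, it suffices to show reg(J : m) ≤ reg I, which has two parts.
--
-- The ideal J : m is I^{(s+1)} : m plus variables (`SimpleGraph.add_edgeSum_mem_union_iff`).
-- Suppose that a larger product m' divides x^a m, where x^a m is not in I^{(s+1)}. Some minimal
-- vertex cover C then forces m and m' to agree on C and each of their edges to have just one end in
-- C. The other ends form products of neighbours of the same vertices, and the exchange property of
-- such products yields a variable z dividing x^a such that z m is divisible by a product larger
-- than m. Adding variables does not raise the regularity bound.
--
-- The regularity of I^{(s+1)} : m is at most that of I
-- (`SimpleGraph.regLE_supportIn_transversals`). Treating the edges xy of m one by one replaces an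
-- ideal W by (W : x) ∩ (W : y), starting from W = I. Each W is squarefree, generated in degree at
-- most two and contains xy. The sum (W : x) + (W : y) is generated by variables and a restriction H
-- of W with reg H ≤ reg W - 1, so Mayer–Vietoris bounds the intersection (`RegLE.inter_colon`).
--
-- Bounds are carried by multigraded resolutions of arbitrary finite length that need not be
-- minimal. A multigraded torsion-free module is encoded as a filtration of a K-vector space by
-- exponents, so that colons, restrictions and shifts become pullbacks of filtrations.
-- `RegLE.shift_le` and `exists_minimalGradedFreeResolution` translate to graded Betti numbers, and
-- `symbolicPower_edgeIdeal` describes the symbolic powers by minimal covers.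

universe u v

/-! ### Bounded free resolutions for abstract gradings -/

/-- A system of additive groups `comp i j` of ring elements, indexed by pairs of degrees, that
contains the units and is closed under composition. -/
structure HomSystem (R Γ : Type*) [CommRing R] where
  comp : Γ → Γ → AddSubgroup R
  one_mem : ∀ j, 1 ∈ comp j j
  mul_mem : ∀ {i j k a b}, a ∈ comp j k → b ∈ comp i j → a * b ∈ comp i k

namespace HomSystem

variable {R : Type u} {Γ : Type*} [CommRing R] (𝒜 : HomSystem R Γ)

/-- A family of subgroups on which the elements of `𝒜.comp i j` act from degree `i` to `j`. -/
def Stable {E : Type*} [AddCommGroup E] [Module R E] (N : Γ → AddSubgroup E) : Prop :=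
  ∀ ⦃i j a x⦄, a ∈ 𝒜.comp i j → x ∈ N i → a • x ∈ N j

/-- The family of components of the free module with basis vectors in the degrees `b`. -/
def free {ι : Type*} (b : ι → Γ) (j : Γ) : AddSubgroup (ι → R) :=
  AddSubgroup.pi Set.univ fun i => 𝒜.comp (b i) j

/-- The family of components of the kernel of `f` on `N`. -/
def kerFamily {E E' : Type*} [AddCommGroup E] [Module R E] [AddCommGroup E'] [Module R E']
    (N : Γ → AddSubgroup E) (f : E →ₗ[R] E') (j : Γ) : AddSubgroup E :=
  N j ⊓ f.toAddMonoidHom.ker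

/-- The family of components of the image of `N`. -/
def mapFamily {E E' : Type*} [AddCommGroup E] [Module R E] [AddCommGroup E'] [Module R E']
    (N : Γ → AddSubgroup E) (f : E →ₗ[R] E') (j : Γ) : AddSubgroup E' :=
  (N j).map f.toAddMonoidHom

/-- `N` has a free resolution of length `n` whose generators in homological degree `i` have their
degrees in `B (r + i)`. -/
def Resolved (B : ℤ → Set Γ) : ℕ → ℤ →
    ∀ {E : Type u} [AddCommGroup E] [Module R E], (Γ → AddSubgroup E) → Prop
  | 0, _, _, _, _, _ => True
  | n + 1, r, E, _, _, N => ∃ (ι : Type) (_ : Fintype ι) (b : ι → Γ) (f : (ι → R) →ₗ[R] E),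
      (∀ i, b i ∈ B r) ∧ mapFamily (𝒜.free b) f = N ∧
        Resolved B n (r + 1) (kerFamily (𝒜.free b) f)

variable {𝒜}

section Basic

variable {E E' : Type*} [AddCommGroup E] [Module R E] [AddCommGroup E'] [Module R E']

theorem mem_free {ι : Type*} {b : ι → Γ} {j : Γ} {c : ι → R} :
    c ∈ 𝒜.free b j ↔ ∀ i, c i ∈ 𝒜.comp (b i) j := by
  simp [free, AddSubgroup.mem_pi]

theorem mem_kerFamily {N : Γ → AddSubgroup E} {f : E →ₗ[R] E'} {j : Γ} {x : E} :
    x ∈ kerFamily N f j ↔ x ∈ N j ∧ f x = 0 := Iff.rfl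

theorem mapFamily_eq_iff {N : Γ → AddSubgroup E} {f : E →ₗ[R] E'} {M : Γ → AddSubgroup E'} :
    mapFamily N f = M ↔ (∀ j, ∀ x ∈ N j, f x ∈ M j) ∧ ∀ j, ∀ y ∈ M j, ∃ x ∈ N j, f x = y := by
  constructor
  · rintro rfl
    exact ⟨fun j x hx => ⟨x, hx, rfl⟩, fun j y hy => hy⟩
  · rintro ⟨h₁, h₂⟩
    funext j
    ext y
    refine ⟨?_, h₂ j y⟩
    rintro ⟨x, hx, rfl⟩
    exact h₁ j x hx

theorem mapFamily_id (N : Γ → AddSubgroup E) : mapFamily N (LinearMap.id (R := R)) = N :=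
  mapFamily_eq_iff.2 ⟨fun _ _ hx => hx, fun _ y hy => ⟨y, hy, rfl⟩⟩

theorem mapFamily_comp {E'' : Type*} [AddCommGroup E''] [Module R E''] (N : Γ → AddSubgroup E)
    (f : E →ₗ[R] E') (g : E' →ₗ[R] E'') :
    mapFamily N (g ∘ₗ f) = mapFamily (mapFamily N f) g := by
  rw [mapFamily_eq_iff]
  refine ⟨fun j x hx => ⟨f x, ⟨x, hx, rfl⟩, rfl⟩, ?_⟩
  rintro j _ ⟨_, ⟨x, hx, rfl⟩, rfl⟩
  exact ⟨x, hx, rfl⟩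

theorem stable_free {ι : Type*} (b : ι → Γ) : 𝒜.Stable (𝒜.free b) := by
  intro i j a x ha hx
  rw [mem_free] at hx ⊢
  exact fun k => 𝒜.mul_mem ha (hx k)

theorem Stable.ker {N : Γ → AddSubgroup E} (hN : 𝒜.Stable N) (f : E →ₗ[R] E') :
    𝒜.Stable (kerFamily N f) := by
  intro i j a x ha hx
  exact ⟨hN ha hx.1, by
    have : f x = 0 := hx.2
    simp [this]⟩

theorem Stable.map {N : Γ → AddSubgroup E} (hN : 𝒜.Stable N) (f : E →ₗ[R] E') :
    𝒜.Stable (mapFamily N f) := by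
  rintro i j a _ ha ⟨x, hx, rfl⟩
  exact ⟨a • x, hN ha hx, by simp⟩

theorem single_mem_free {ι : Type*} [DecidableEq ι] (b : ι → Γ) (i : ι) :
    Pi.single i (1 : R) ∈ 𝒜.free b (b i) := by
  rw [mem_free]
  intro k
  by_cases h : k = i
  · subst h
    simpa using 𝒜.one_mem _
  · simp [h, zero_mem]

/-- A homomorphism out of a free module given on basis vectors is homogeneous. -/
theorem linearCombination_mem {ι : Type*} [Fintype ι] {b : ι → Γ} {N : Γ → AddSubgroup E}
    (hN : 𝒜.Stable N) {y : ι → E} (hy : ∀ i, y i ∈ N (b i)) {j : Γ} {c : ι → R}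
    (hc : c ∈ 𝒜.free b j) : Fintype.linearCombination R y c ∈ N j := by
  rw [Fintype.linearCombination_apply]
  exact sum_mem fun i _ => hN (mem_free.1 hc i) (hy i)

/-- Homomorphisms out of a free module lift along a surjection of families. -/
theorem exists_lift {ι : Type*} [Fintype ι] {b : ι → Γ} {N : Γ → AddSubgroup E}
    (hN : 𝒜.Stable N) {p : E →ₗ[R] E'} {f : (ι → R) →ₗ[R] E'}
    (hf : ∀ j, ∀ c ∈ 𝒜.free b j, f c ∈ mapFamily N p j) :
    ∃ g : (ι → R) →ₗ[R] E, p ∘ₗ g = f ∧ ∀ j, ∀ c ∈ 𝒜.free b j, g c ∈ N j := by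
  classical
  choose y hy hpy using fun i => hf (b i) _ (single_mem_free b i)
  refine ⟨Fintype.linearCombination R y, ?_, fun j c hc => linearCombination_mem hN hy hc⟩
  refine LinearMap.pi_ext' fun i => LinearMap.ext_ring ?_
  have : p (y i) = f (Pi.single i 1) := hpy i
  simpa [Fintype.linearCombination_apply_single] using this

end Basic

variable {B : ℤ → Set Γ} {E E' : Type u} [AddCommGroup E] [Module R E] [AddCommGroup E']
  [Module R E']

theorem Resolved.mono (hB : Monotone B) {n : ℕ} {r r' : ℤ} (hr : r ≤ r') {N : Γ → AddSubgroup E}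
    (h : 𝒜.Resolved B n r N) : 𝒜.Resolved B n r' N := by
  induction n generalizing r r' E with
  | zero => trivial
  | succ n ih =>
    obtain ⟨ι, i, b, f, hb, hN, hK⟩ := h
    exact ⟨ι, i, b, f, fun k => hB hr (hb k), hN, ih (by omega) hK⟩

theorem Resolved.of_succ {n : ℕ} {r : ℤ} {N : Γ → AddSubgroup E}
    (h : 𝒜.Resolved B (n + 1) r N) : 𝒜.Resolved B n r N := by
  induction n generalizing r E with
  | zero => trivial
  | succ n ih =>
    obtain ⟨ι, i, b, f, hb, hN, hK⟩ := h
    exact ⟨ι, i, b, f, hb, hN, ih hK⟩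

theorem Resolved.map_of_injOn {n : ℕ} {r : ℤ} {N : Γ → AddSubgroup E} {f : E →ₗ[R] E'}
    (hf : ∀ j, ∀ x ∈ N j, f x = 0 → x = 0) (h : 𝒜.Resolved B n r N) :
    𝒜.Resolved B n r (mapFamily N f) := by
  cases n with
  | zero => trivial
  | succ n =>
    obtain ⟨ι, i, b, g, hb, rfl, hK⟩ := h
    refine ⟨ι, i, b, f ∘ₗ g, hb, ?_, ?_⟩
    · exact mapFamily_comp _ _ _
    · convert hK using 1
      funext j
      ext c
      simp only [mem_kerFamily, LinearMap.comp_apply]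
      refine and_congr_right fun hc => ⟨fun h0 => hf j _ ⟨c, hc, rfl⟩ h0, fun h0 => by simp [h0]⟩

theorem resolved_bot (n : ℕ) (r : ℤ) : 𝒜.Resolved B n r (fun _ => (⊥ : AddSubgroup E)) := by
  induction n generalizing r E with
  | zero => trivial
  | succ n ih =>
    refine ⟨Empty, inferInstance, Empty.elim, 0, fun i => i.elim, ?_, ?_⟩
    · rw [mapFamily_eq_iff]
      refine ⟨fun j x _ => by simp, fun j y hy => ⟨0, zero_mem _, ?_⟩⟩
      simpa using (AddSubgroup.mem_bot.1 hy).symm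
    · convert ih (r + 1) using 1
      funext j
      exact Subsingleton.elim _ _

theorem resolved_free {ι : Type} [Fintype ι] {b : ι → Γ} {r : ℤ} (hb : ∀ i, b i ∈ B r) (n : ℕ) :
    𝒜.Resolved B n r (𝒜.free b) := by
  cases n with
  | zero => trivial
  | succ n =>
    refine ⟨ι, inferInstance, b, LinearMap.id, hb, ?_, ?_⟩
    · exact mapFamily_id _
    · convert resolved_bot (𝒜 := 𝒜) (B := B) (E := ι → R) n (r + 1) using 1
      funext j
      ext c
      rw [mem_kerFamily, AddSubgroup.mem_bot]
      exact ⟨fun h => h.2, fun h => ⟨h ▸ zero_mem _, h⟩⟩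

/-- This is the horseshoe lemma. Generators of the image lift to `M` and, with those of the kernel,
cover `M`; the syzygies are again an extension, with the two old syzygy families as kernel and
image. -/
theorem Resolved.extension {n : ℕ} {r : ℤ} {M : Γ → AddSubgroup E} (hM : 𝒜.Stable M)
    (p : E →ₗ[R] E') (h₁ : 𝒜.Resolved B n r (kerFamily M p))
    (h₃ : 𝒜.Resolved B n r (mapFamily M p)) : 𝒜.Resolved B n r M := by
  induction n generalizing r E E' with
  | zero => trivial
  | succ n ih =>
    obtain ⟨ι₁, _, b₁, f₁, hb₁, hN₁, hK₁⟩ := h₁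
    obtain ⟨ι₃, _, b₃, f₃, hb₃, hN₃, hK₃⟩ := h₃
    obtain ⟨g, hg, hgM⟩ := exists_lift (𝒜 := 𝒜) hM (p := p) (f := f₃) (b := b₃)
      (fun j c hc => hN₃ ▸ ⟨c, hc, rfl⟩)
    rw [mapFamily_eq_iff] at hN₁ hN₃
    have hpg : ∀ c, p (g c) = f₃ c := fun c => by rw [← hg]; rfl
    let l : (ι₁ ⊕ ι₃ → R) →ₗ[R] (ι₁ → R) := LinearMap.funLeft R R Sum.inl
    let q : (ι₁ ⊕ ι₃ → R) →ₗ[R] (ι₃ → R) := LinearMap.funLeft R R Sum.inr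
    let f : (ι₁ ⊕ ι₃ → R) →ₗ[R] E := f₁ ∘ₗ l + g ∘ₗ q
    have hfr : ∀ c j, c ∈ 𝒜.free (Sum.elim b₁ b₃) j ↔ l c ∈ 𝒜.free b₁ j ∧ q c ∈ 𝒜.free b₃ j := by
      intro c j
      simp only [mem_free, Sum.forall]
      rfl
    have hpf₁ : ∀ j, ∀ c ∈ 𝒜.free b₁ j, p (f₁ c) = 0 := fun j c hc => (hN₁.1 j c hc).2
    refine ⟨ι₁ ⊕ ι₃, inferInstance, Sum.elim b₁ b₃, f, ?_, ?_, ?_⟩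
    · rintro (i | i)
      exacts [hb₁ i, hb₃ i]
    · rw [mapFamily_eq_iff]
      refine ⟨fun j c hc => ?_, fun j y hy => ?_⟩
      · rw [hfr] at hc
        exact (M j).add_mem (hN₁.1 j _ hc.1).1 (hgM j _ hc.2)
      · obtain ⟨c₃, hc₃, h₃⟩ := hN₃.2 j (p y) ⟨y, hy, rfl⟩
        obtain ⟨c₁, hc₁, h₁⟩ := hN₁.2 j (y - g c₃) ⟨(M j).sub_mem hy (hgM j _ hc₃), by
          change p (y - g c₃) = 0
          rw [map_sub, hpg, h₃, sub_self]⟩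
        refine ⟨Sum.elim c₁ c₃, (hfr _ _).2 ⟨hc₁, hc₃⟩, ?_⟩
        change f₁ c₁ + g c₃ = y
        rw [h₁, sub_add_cancel]
    · refine ih ((stable_free _).ker f) q ?_ ?_
      · let i₁ : (ι₁ → R) →ₗ[R] (ι₁ ⊕ ι₃ → R) :=
          (LinearEquiv.sumArrowLequivProdArrow ι₁ ι₃ R R).symm.toLinearMap ∘ₗ LinearMap.inl R _ _
        have hl : ∀ c, l (i₁ c) = c := fun c => rfl
        have hq : ∀ c, q (i₁ c) = 0 := fun c => rfl
        have := hK₁.map_of_injOn (f := i₁) (fun j x _ h0 => by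
          have := congrArg l h0
          rwa [hl, map_zero] at this)
        convert this using 1
        symm
        rw [mapFamily_eq_iff]
        refine ⟨fun j c hc => ⟨⟨(hfr _ _).2 ⟨hc.1, by rw [hq]; exact zero_mem _⟩, ?_⟩, hq c⟩,
          fun j c hc => ⟨l c, ⟨((hfr _ _).1 hc.1.1).1, ?_⟩, ?_⟩⟩
        · change f₁ (l (i₁ c)) + g (q (i₁ c)) = 0
          rw [hq, hl, map_zero, add_zero]
          exact hc.2
        · have h0 : f₁ (l c) + g (q c) = 0 := hc.1.2
          have hq0 : q c = 0 := hc.2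
          rwa [hq0, map_zero, add_zero] at h0
        · have hq0 : q c = 0 := hc.2
          funext i
          rcases i with i | i
          · rfl
          · exact (congrFun hq0 i).symm
      · convert hK₃ using 1
        rw [mapFamily_eq_iff]
        refine ⟨fun j c hc => ⟨((hfr _ _).1 hc.1).2, ?_⟩, fun j c₃ hc₃ => ?_⟩
        · have h0 : f₁ (l c) + g (q c) = 0 := hc.2
          have := congrArg p h0
          rwa [map_add, hpf₁ j _ ((hfr _ _).1 hc.1).1, zero_add, hpg, map_zero] at this
        · obtain ⟨c₁, hc₁, h₁⟩ := hN₁.2 j (g c₃) ⟨hgM j _ hc₃.1, (hpg c₃).trans hc₃.2⟩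
          refine ⟨Sum.elim (-c₁) c₃, ⟨(hfr _ _).2 ⟨neg_mem hc₁, hc₃.1⟩, ?_⟩, rfl⟩
          change f₁ (-c₁) + g c₃ = 0
          rw [map_neg, h₁, neg_add_cancel]

/-- A cover `f` of `M` also covers the image under `p`. Its new syzygies are mapped by `f` onto the
kernel of `p`, with the old syzygies as kernel, so the horseshoe lemma applies. -/
theorem Resolved.quotient {n : ℕ} {r : ℤ} {M : Γ → AddSubgroup E} (p : E →ₗ[R] E')
    (h₁ : 𝒜.Resolved B n (r + 1) (kerFamily M p)) (h₂ : 𝒜.Resolved B (n + 1) r M) :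
    𝒜.Resolved B (n + 1) r (mapFamily M p) := by
  obtain ⟨ι, _, b, f, hb, rfl, hK⟩ := h₂
  refine ⟨ι, inferInstance, b, p ∘ₗ f, hb, ?_, ?_⟩
  · exact mapFamily_comp _ _ _
  · refine Resolved.extension ((stable_free b).ker _) f ?_ ?_
    · convert hK using 1
      funext j
      ext c
      simp only [mem_kerFamily, LinearMap.comp_apply, and_assoc]
      refine and_congr_right fun _ => ⟨fun h => h.2, fun h => ⟨by simp [h], h⟩⟩
    · convert h₁ using 1
      rw [mapFamily_eq_iff]
      refine ⟨fun j c hc => ⟨⟨c, hc.1, rfl⟩, hc.2⟩, ?_⟩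
      rintro j _ ⟨⟨c, hc, rfl⟩, h0⟩
      exact ⟨c, ⟨hc, h0⟩, rfl⟩

/-- Let F cover the image C of `M`, and form the fibre product X of `M` and F over C. Over `M`, it
is an extension with the syzygies of C as kernel, so it is resolved; as F lifts to `M`, the kernel
of `p` is the quotient of X by a copy of F. -/
theorem Resolved.kernel (hB : Monotone B) {n : ℕ} {r : ℤ} {M : Γ → AddSubgroup E}
    (hM : 𝒜.Stable M) (p : E →ₗ[R] E') (h₂ : 𝒜.Resolved B n r M)
    (h₃ : 𝒜.Resolved B (n + 1) (r - 1) (mapFamily M p)) :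
    𝒜.Resolved B n r (kerFamily M p) := by
  cases n with
  | zero => trivial
  | succ n =>
    obtain ⟨ι, _, b, f, hb, hN, hK⟩ := h₃
    obtain ⟨g, hg, hgM⟩ := exists_lift (𝒜 := 𝒜) hM (p := p) (f := f) (b := b)
      (fun j c hc => hN ▸ ⟨c, hc, rfl⟩)
    have hpg : ∀ c, p (g c) = f c := fun c => by rw [← hg]; rfl
    rw [mapFamily_eq_iff] at hN
    rw [sub_add_cancel] at hK
    let X : Γ → AddSubgroup (E × (ι → R)) :=
      kerFamily (fun j => (M j).prod (𝒜.free b j)) (p.coprod (-f))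
    have hX : ∀ j y, y ∈ X j ↔ (y.1 ∈ M j ∧ y.2 ∈ 𝒜.free b j) ∧ p y.1 = f y.2 := by
      intro j y
      simp only [X, mem_kerFamily, AddSubgroup.mem_prod, LinearMap.coprod_apply,
        LinearMap.neg_apply, ← sub_eq_add_neg, sub_eq_zero]
    have hXs : 𝒜.Stable X := by
      refine Stable.ker (fun i j a x ha hx => ?_) _
      rw [AddSubgroup.mem_prod] at hx ⊢
      exact ⟨hM ha hx.1, stable_free b ha hx.2⟩
    have hXr : 𝒜.Resolved B (n + 1) r X := by
      refine Resolved.extension hXs (LinearMap.fst R E (ι → R)) ?_ ?_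
      · convert hK.map_of_injOn (f := LinearMap.inr R E (ι → R)) (fun j x _ h0 => by
          simpa using h0) using 1
        symm
        rw [mapFamily_eq_iff]
        refine ⟨fun j c hc => ⟨(hX _ _).2 ⟨⟨zero_mem _, hc.1⟩, ?_⟩, rfl⟩, ?_⟩
        · exact (map_zero p).trans hc.2.symm
        · rintro j ⟨y, c⟩ hc
          have hy : y = 0 := hc.2
          subst hy
          have := (hX _ _).1 hc.1
          exact ⟨c, ⟨this.1.2, this.2.symm.trans (map_zero p)⟩, rfl⟩
      · convert h₂ using 1
        rw [mapFamily_eq_iff]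
        refine ⟨fun j y hy => ((hX _ _).1 hy).1.1, fun j y hy => ?_⟩
        obtain ⟨c, hc, h⟩ := hN.2 j (p y) ⟨y, hy, rfl⟩
        exact ⟨(y, c), (hX _ _).2 ⟨⟨hy, hc⟩, h.symm⟩, rfl⟩
    -- The retraction (y, c) ↦ y - g c of X onto the kernel of `p`; its own kernel is the graph of
    -- `g`, which is free.
    have hq : mapFamily X (LinearMap.fst R E (ι → R) - g ∘ₗ LinearMap.snd R E (ι → R)) =
        kerFamily M p := by
      rw [mapFamily_eq_iff]
      refine ⟨fun j y hy => ?_, fun j y hy => ⟨(y, 0), (hX _ _).2 ⟨⟨hy.1, zero_mem _⟩, ?_⟩, ?_⟩⟩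
      · rw [hX] at hy
        refine ⟨(M j).sub_mem hy.1.1 (hgM j _ hy.1.2), ?_⟩
        change p (y.1 - g y.2) = 0
        rw [map_sub, hpg, hy.2, sub_self]
      · exact (show p y = 0 from hy.2).trans (map_zero f).symm
      · simp
    rw [← hq]
    refine Resolved.quotient _ ?_ hXr
    have hfree : 𝒜.Resolved B n (r + 1) (𝒜.free b) :=
      resolved_free (fun i => hB (by omega) (hb i)) n
    convert hfree.map_of_injOn (f := g.prod LinearMap.id) (fun j x _ h0 => by
      simpa using (Prod.ext_iff.1 h0).2) using 1
    symm
    rw [mapFamily_eq_iff]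
    refine ⟨fun j c hc => ⟨(hX _ _).2 ⟨⟨hgM j c hc, hc⟩, hpg c⟩, ?_⟩, fun j y hy => ?_⟩
    · exact sub_self (g c)
    · have h0 : y.1 - g y.2 = 0 := hy.2
      exact ⟨y.2, ((hX _ _).1 hy.1).1.2, Prod.ext (sub_eq_zero.1 h0).symm rfl⟩

end HomSystem

/-! ### Multigraded modules as filtrations of vector spaces -/

/-- The homomorphism system of a preorder: scalars in all degrees `i ≤ j`. Its stable families are
the filtrations of vector spaces indexed by the preorder. -/
def HomSystem.ofPreorder (K Γ : Type*) [CommRing K] [Preorder Γ] : HomSystem K Γ where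
  comp i j := ⨆ _ : i ≤ j, ⊤
  one_mem j := by simp
  mul_mem {i j k a b} ha hb := by
    by_cases h₁ : i ≤ j <;> by_cases h₂ : j ≤ k <;> simp_all [zero_mem]
    simp [h₁.trans h₂]

namespace HomSystem

section Preorder

variable {K : Type u} {Γ : Type*} [CommRing K] [Preorder Γ]

theorem mem_ofPreorder_comp {i j : Γ} {a : K} :
    a ∈ (ofPreorder K Γ).comp i j ↔ (a ≠ 0 → i ≤ j) := by
  by_cases h : i ≤ j
  · simp [ofPreorder, h]
  · simp [ofPreorder, h]

theorem stable_ofPreorder_iff {E : Type*} [AddCommGroup E] [Module K E] {N : Γ → AddSubgroup E} :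
    (ofPreorder K Γ).Stable N ↔ Monotone N ∧ ∀ i (a : K), ∀ x ∈ N i, a • x ∈ N i := by
  constructor
  · intro h
    refine ⟨fun i j hij x hx => ?_, fun i a x hx => h (mem_ofPreorder_comp.2 fun _ => le_rfl) hx⟩
    simpa using h (a := 1) (mem_ofPreorder_comp.2 fun _ => hij) hx
  · rintro ⟨h₁, h₂⟩ i j a x ha hx
    rw [mem_ofPreorder_comp] at ha
    by_cases h : a = 0
    · simp [h, zero_mem]
    · exact h₁ (ha h) (h₂ i a x hx)

theorem mem_free_ofPreorder {ι : Type*} {b : ι → Γ} {a : Γ} {c : ι → K} :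
    c ∈ (ofPreorder K Γ).free b a ↔ ∀ i, c i ≠ 0 → b i ≤ a := by
  simp [mem_free, mem_ofPreorder_comp]

open Classical in
/-- The pullback of a family along a map `φ` that is only defined on `D`, and zero off `D`. -/
noncomputable def pull {E : Type*} [AddCommGroup E] (D : Set Γ) (φ : Γ → Γ) (N : Γ → AddSubgroup E) (a : Γ) :
    AddSubgroup E :=
  if a ∈ D then N (φ a) else ⊥

variable {E : Type u} [AddCommGroup E] [Module K E] {B B' : ℤ → Set Γ}

/-- Pulling back is exact, and the hypothesis makes the pullback of each free generator either zero
or free on one generator of controlled degree. A resolution is therefore pulled back term by term.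
-/
theorem Resolved.pull {D : Set Γ} {φ : Γ → Γ} {t : ℤ}
    (hφ : ∀ r, ∀ b ∈ B r, (∀ a ∈ D, ¬ b ≤ φ a) ∨ ∃ c ∈ B' (r + t), ∀ a, a ∈ D ∧ b ≤ φ a ↔ c ≤ a)
    {n : ℕ} {r : ℤ} {N : Γ → AddSubgroup E} (h : (ofPreorder K Γ).Resolved B n r N) :
    (ofPreorder K Γ).Resolved B' n (r + t) (HomSystem.pull D φ N) := by
  classical
  induction n generalizing r E with
  | zero => trivial
  | succ n ih =>
    obtain ⟨ι, _, b, f, hb, rfl, hK⟩ := h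
    let P : ι → Prop := fun i => ∃ c ∈ B' (r + t), ∀ a, a ∈ D ∧ b i ≤ φ a ↔ c ≤ a
    choose l hl hlb using fun i : {i // P i} => i.2
    let e : ({i // P i} → K) →ₗ[K] (ι → K) := Function.ExtendByZero.linearMap K Subtype.val
    let q : (ι → K) →ₗ[K] ({i // P i} → K) := LinearMap.funLeft K K Subtype.val
    have he : ∀ c i, e c i.1 = c i := fun c i => by
      simp [e]
    have he0 : ∀ c i, ¬ P i → e c i = 0 := fun c i hi => by
      simp only [e, Function.ExtendByZero.linearMap_apply]
      rw [Function.extend_apply' _ _ _ (by rintro ⟨x, rfl⟩; exact hi x.2)]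
      rfl
    have hfree : ∀ a c, c ∈ (ofPreorder K Γ).free l a ↔
        (c ≠ 0 → a ∈ D) ∧ e c ∈ (ofPreorder K Γ).free b (φ a) := by
      intro a c
      simp only [mem_free_ofPreorder]
      constructor
      · intro h
        refine ⟨fun hc => ?_, fun i hi => ?_⟩
        · obtain ⟨i, hi⟩ := Function.ne_iff.1 hc
          exact ((hlb i a).2 (h i hi)).1
        · by_cases hP : P i
          · exact ((hlb ⟨i, hP⟩ a).2 (h ⟨i, hP⟩ (by rwa [← he c ⟨i, hP⟩]))).2
          · exact absurd (he0 c i hP) hi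
      · rintro ⟨h₁, h₂⟩ i hi
        exact (hlb i a).1 ⟨h₁ (fun h => hi (by rw [h]; rfl)), h₂ i.1 (by rwa [he])⟩
    -- In degrees of `D`, an element has no component at the generators whose pullback is zero, so
    -- dropping them loses nothing.
    have hext : ∀ a ∈ D, ∀ x ∈ (ofPreorder K Γ).free b (φ a), e (q x) = x := by
      intro a ha x hx
      funext i
      by_cases hP : P i
      · exact he (q x) ⟨i, hP⟩
      · rw [he0 _ _ hP]
        by_contra hne
        exact ((hφ r (b i) (hb i)).resolve_right hP) a ha (mem_free_ofPreorder.1 hx i (Ne.symm hne))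
    refine ⟨{i // P i}, inferInstance, l, f ∘ₗ e, hl, ?_, ?_⟩
    · rw [mapFamily_eq_iff]
      refine ⟨fun a c hc => ?_, fun a y hy => ?_⟩
      · rw [hfree] at hc
        by_cases ha : a ∈ D
        · rw [HomSystem.pull, if_pos ha]
          exact ⟨e c, hc.2, rfl⟩
        · have : c = 0 := by
            by_contra h
            exact ha (hc.1 h)
          rw [this, map_zero]
          exact zero_mem _
      · by_cases ha : a ∈ D
        · rw [HomSystem.pull, if_pos ha] at hy
          obtain ⟨x, hx, rfl⟩ := hy
          refine ⟨q x, (hfree _ _).2 ⟨fun _ => ha, by rwa [hext a ha x hx]⟩, ?_⟩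
          exact congrArg f (hext a ha x hx)
        · rw [HomSystem.pull, if_neg ha] at hy
          exact ⟨0, zero_mem _, by rw [AddSubgroup.mem_bot.1 hy, map_zero]⟩
    · have h1 := (ih hK).map_of_injOn (f := q) (fun a x hx h0 => by
        by_cases ha : a ∈ D
        · rw [HomSystem.pull, if_pos ha] at hx
          rw [← hext a ha x hx.1, h0, map_zero]
        · rw [HomSystem.pull, if_neg ha] at hx
          exact hx)
      convert h1 using 1
      · omega
      · symm
        rw [mapFamily_eq_iff]
        refine ⟨fun a x hx => ?_, fun a c hc => ?_⟩
        · by_cases ha : a ∈ D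
          · rw [HomSystem.pull, if_pos ha] at hx
            have h2 := hext a ha x hx.1
            refine ⟨(hfree _ _).2 ⟨fun _ => ha, by rw [h2]; exact hx.1⟩, ?_⟩
            exact (congrArg f h2).trans hx.2
          · rw [HomSystem.pull, if_neg ha] at hx
            rw [AddSubgroup.mem_bot.1 hx, map_zero]
            exact zero_mem _
        · have h2 := (hfree _ _).1 hc.1
          have hqe : q (e c) = c := funext fun i => he c i
          refine ⟨e c, ?_, hqe⟩
          by_cases ha : a ∈ D
          · rw [HomSystem.pull, if_pos ha]
            exact ⟨h2.2, hc.2⟩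
          · have : c = 0 := by
              by_contra h
              exact ha (h2.1 h)
            rw [this, map_zero]
            exact zero_mem _

/-- If a family vanishes off the upper set `D`, then a resolution only needs generators whose
degrees are in `D`. -/
theorem Resolved.strip (hB : Monotone B) {D : Set Γ} (hD : IsUpperSet D) {n : ℕ} {r : ℤ}
    {N : Γ → AddSubgroup E} (hN : ∀ a, a ∉ D → N a = ⊥) (h : (ofPreorder K Γ).Resolved B n r N) :
    (ofPreorder K Γ).Resolved (fun k => B k ∩ D) n r N := by
  classical
  induction n generalizing r E with
  | zero => trivial
  | succ n ih =>
    obtain ⟨ι, _, b, f, hb, rfl, hK⟩ := h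
    let b' : {i // b i ∈ D} → Γ := fun i => b i
    let b'' : {i // b i ∉ D} → Γ := fun i => b i
    let e : ({i // b i ∈ D} → K) →ₗ[K] (ι → K) := Function.ExtendByZero.linearMap K Subtype.val
    let e' : ({i // b i ∉ D} → K) →ₗ[K] (ι → K) := Function.ExtendByZero.linearMap K Subtype.val
    let q : (ι → K) →ₗ[K] ({i // b i ∈ D} → K) := LinearMap.funLeft K K Subtype.val
    have he : ∀ c (i : {i // b i ∈ D}), e c i.1 = c i := fun c i => by
      simp [e]
    have he0 : ∀ c i, b i ∉ D → e c i = 0 := fun c i hi => by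
      simp only [e, Function.ExtendByZero.linearMap_apply]
      rw [Function.extend_apply' _ _ _ (by rintro ⟨x, rfl⟩; exact hi x.2)]
      rfl
    have he' : ∀ c (i : {i // b i ∉ D}), e' c i.1 = c i := fun c i => by
      simp [e']
    have he0' : ∀ c i, b i ∈ D → e' c i = 0 := fun c i hi => by
      simp only [e', Function.ExtendByZero.linearMap_apply]
      rw [Function.extend_apply' _ _ _ (by rintro ⟨x, rfl⟩; exact x.2 hi)]
      rfl
    -- A generator in a degree outside `D` maps into a zero component, hence `f` kills it.
    have hf : ∀ x, f (e (q x)) = f x := by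
      have h0 : f ∘ₗ e ∘ₗ q = f := by
        refine LinearMap.pi_ext' fun i => LinearMap.ext_ring ?_
        change f (e (q (Pi.single i 1))) = f (Pi.single i 1)
        by_cases hi : b i ∈ D
        · congr 1
          funext k
          by_cases hk : b k ∈ D
          · exact he _ ⟨k, hk⟩
          · rw [he0 _ _ hk, Pi.single_eq_of_ne]
            rintro rfl
            exact hk hi
        · have h1 : f (Pi.single i 1) = 0 := by
            have : f (Pi.single i 1) ∈ mapFamily ((ofPreorder K Γ).free b) f (b i) :=
              ⟨_, single_mem_free b i, rfl⟩
            rwa [hN _ hi, AddSubgroup.mem_bot] at this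
          have h2 : q (Pi.single i 1) = 0 := by
            funext k
            have hki : (k : ι) ≠ i := fun h => hi (h ▸ k.2)
            exact Pi.single_eq_of_ne hki _
          rw [h1, h2, map_zero, map_zero]
      exact fun x => LinearMap.congr_fun h0 x
    have hefree : ∀ a c, c ∈ (ofPreorder K Γ).free b' a → e c ∈ (ofPreorder K Γ).free b a := by
      intro a c hc
      rw [mem_free_ofPreorder] at hc ⊢
      intro i hi
      by_cases h : b i ∈ D
      · exact hc ⟨i, h⟩ (by rwa [← he c ⟨i, h⟩])
      · exact absurd (he0 c i h) hi
    have hqfree : ∀ a x, x ∈ (ofPreorder K Γ).free b a → q x ∈ (ofPreorder K Γ).free b' a := by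
      intro a x hx
      rw [mem_free_ofPreorder] at hx ⊢
      exact fun i hi => hx i.1 hi
    have hqe : ∀ c, q (e c) = c := fun c => funext fun i => he c i
    refine ⟨{i // b i ∈ D}, inferInstance, b', f ∘ₗ e, fun i => ⟨hb i, i.2⟩, ?_, ?_⟩
    · rw [mapFamily_eq_iff]
      refine ⟨fun a c hc => ⟨e c, hefree a c hc, rfl⟩, ?_⟩
      rintro a _ ⟨x, hx, rfl⟩
      exact ⟨q x, hqfree a x hx, hf x⟩
    · refine ih ?_ ?_
      · intro a ha
        rw [eq_bot_iff]
        intro c hc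
        rw [AddSubgroup.mem_bot]
        funext i
        by_contra hi
        exact ha (hD (mem_free_ofPreorder.1 hc.1 i hi) i.2)
      · have hq : mapFamily (kerFamily ((ofPreorder K Γ).free b) f) q =
            kerFamily ((ofPreorder K Γ).free b') (f ∘ₗ e) := by
          rw [mapFamily_eq_iff]
          refine ⟨fun a x hx => ⟨hqfree a x hx.1, (hf x).trans hx.2⟩, fun a c hc =>
            ⟨e c, ⟨hefree a c hc.1, hc.2⟩, hqe c⟩⟩
        rw [← hq]
        cases n with
        | zero => trivial
        | succ n =>
          -- The reduced syzygies are a quotient of the full ones, and the kernel is free on the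
          -- dropped generators.
          refine Resolved.quotient q ?_ hK
          have hr : r ≤ r + 1 + 1 := by omega
          have hfr : (ofPreorder K Γ).Resolved B n (r + 1 + 1) ((ofPreorder K Γ).free b'') :=
            resolved_free (b := b'') (fun i => hB hr (hb i.1)) n
          convert hfr.map_of_injOn (f := e') (fun a x _ h0 => by
            funext i
            rw [← he' x i, h0]
            rfl) using 1
          symm
          rw [mapFamily_eq_iff]
          refine ⟨fun a c hc => ?_, fun a x hx => ?_⟩
          · have hq0 : q (e' c) = 0 := funext fun i => he0' c i i.2
            refine ⟨⟨?_, ?_⟩, hq0⟩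
            · refine mem_free_ofPreorder.2 fun i hi => ?_
              rw [mem_free_ofPreorder] at hc
              by_cases h : b i ∈ D
              · exact absurd (he0' c i h) hi
              · exact hc ⟨i, h⟩ (by rwa [← he' c ⟨i, h⟩])
            · change f (e' c) = 0
              rw [← hf, hq0, map_zero, map_zero]
          · refine ⟨fun i => x i.1, ?_, ?_⟩
            · rw [mem_free_ofPreorder]
              exact fun i hi => mem_free_ofPreorder.1 hx.1.1 i.1 hi
            · funext i
              by_cases h : b i ∈ D
              · rw [he0' _ _ h]
                exact (congrFun (show q x = 0 from hx.2) ⟨i, h⟩).symm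
              · exact he' _ ⟨i, h⟩

/-! ### Monomial ideals as filtrations of the ground ring -/

open Classical in
/-- The family of components of the monomial ideal with exponent set `U`. -/
noncomputable def monomialFamily (K : Type*) [CommRing K] (U : Set Γ) (a : Γ) : AddSubgroup K :=
  if a ∈ U then ⊤ else ⊥

theorem mem_monomialFamily {Γ : Type*} {U : Set Γ} {a : Γ} {x : K} :
    x ∈ monomialFamily K U a ↔ (x ≠ 0 → a ∈ U) := by
  by_cases h : a ∈ U <;> simp [monomialFamily, h]

theorem stable_monomialFamily {U : Set Γ} (hU : IsUpperSet U) :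
    (ofPreorder K Γ).Stable (monomialFamily K U) := by
  rw [stable_ofPreorder_iff]
  refine ⟨fun i j hij x hx => ?_, fun i a x hx => ?_⟩
  · rw [mem_monomialFamily] at *
    exact fun h => hU hij (hx h)
  · rw [mem_monomialFamily] at *
    exact fun h => hx (right_ne_zero_of_mul h)

theorem pull_monomialFamily {Γ : Type*} (D : Set Γ) (φ : Γ → Γ) (U : Set Γ) :
    pull D φ (monomialFamily K U) = monomialFamily K {a | a ∈ D ∧ φ a ∈ U} := by
  funext a
  by_cases h : a ∈ D <;> by_cases h' : φ a ∈ U <;> simp [pull, monomialFamily, h, h']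

theorem resolved_monomialFamily_Ici {r : ℤ} {c : Γ} (hc : c ∈ B r) (n : ℕ) :
    (ofPreorder K Γ).Resolved B n r (monomialFamily K (Set.Ici c)) := by
  have h : (ofPreorder K Γ).Resolved B n r ((ofPreorder K Γ).free fun _ : Unit => c) :=
    resolved_free (fun _ => hc) n
  convert h.map_of_injOn (f := LinearMap.proj ()) (fun a x _ h0 => funext fun _ => h0) using 1
  symm
  rw [mapFamily_eq_iff]
  refine ⟨fun a x hx => ?_, fun a x hx => ⟨fun _ => x, ?_, rfl⟩⟩
  · rw [mem_monomialFamily]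
    exact mem_free_ofPreorder.1 hx ()
  · rw [mem_free_ofPreorder]
    exact fun _ => mem_monomialFamily.1 hx

theorem resolved_monomialFamily_empty (n : ℕ) (r : ℤ) :
    (ofPreorder K Γ).Resolved B n r (monomialFamily K (∅ : Set Γ)) := by
  convert resolved_bot n r using 1
  funext a
  simp [monomialFamily]

/-! ### The Mayer–Vietoris sequence of two monomial ideals -/

section MayerVietoris

variable {U W : Set Γ} {n : ℕ} {r : ℤ}

theorem stable_prod_monomialFamily (hU : IsUpperSet U) (hW : IsUpperSet W) :
    (ofPreorder K Γ).Stable fun a => (monomialFamily K U a).prod (monomialFamily K W a) := by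
  intro i j a x ha hx
  rw [AddSubgroup.mem_prod] at hx ⊢
  exact ⟨stable_monomialFamily hU ha hx.1, stable_monomialFamily hW ha hx.2⟩

theorem mapFamily_fst_prod {Γ : Type*} {U W : Set Γ} :
    mapFamily (fun a => (monomialFamily K U a).prod (monomialFamily K W a))
      (LinearMap.fst K K K) = monomialFamily K U := by
  rw [mapFamily_eq_iff]
  refine ⟨fun a x hx => (AddSubgroup.mem_prod.1 hx).1, fun a x hx => ⟨(x, 0), ?_, rfl⟩⟩
  exact AddSubgroup.mem_prod.2 ⟨hx, zero_mem _⟩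

theorem Resolved.kerFamily_fst_prod (hW : (ofPreorder K Γ).Resolved B n r (monomialFamily K W)) :
    (ofPreorder K Γ).Resolved B n r
      (kerFamily (fun a => (monomialFamily K U a).prod (monomialFamily K W a))
        (LinearMap.fst K K K)) := by
  convert hW.map_of_injOn (f := LinearMap.inr K K K) (fun a x _ h0 => by simpa using h0) using 1
  symm
  rw [mapFamily_eq_iff]
  refine ⟨fun a x hx => ⟨AddSubgroup.mem_prod.2 ⟨zero_mem _, hx⟩, rfl⟩, ?_⟩
  rintro a ⟨x, y⟩ ⟨h₁, h₂⟩
  have hx : x = 0 := h₂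
  subst hx
  exact ⟨y, (AddSubgroup.mem_prod.1 h₁).2, rfl⟩

theorem Resolved.prod_monomialFamily (hU : IsUpperSet U) (hW : IsUpperSet W)
    (h₁ : (ofPreorder K Γ).Resolved B n r (monomialFamily K U))
    (h₂ : (ofPreorder K Γ).Resolved B n r (monomialFamily K W)) :
    (ofPreorder K Γ).Resolved B n r
      fun a => (monomialFamily K U a).prod (monomialFamily K W a) := by
  refine Resolved.extension (stable_prod_monomialFamily hU hW) (LinearMap.fst K K K) ?_ ?_
  · exact h₂.kerFamily_fst_prod
  · rwa [mapFamily_fst_prod]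

theorem mapFamily_add_prod {Γ : Type*} {U W : Set Γ} :
    mapFamily (fun a => (monomialFamily K U a).prod (monomialFamily K W a))
      ((LinearMap.fst K K K) + LinearMap.snd K K K) = monomialFamily K (U ∪ W) := by
  rw [mapFamily_eq_iff]
  refine ⟨fun a x hx => ?_, fun a x hx => ?_⟩
  · rw [AddSubgroup.mem_prod, mem_monomialFamily, mem_monomialFamily] at hx
    rw [mem_monomialFamily]
    intro h
    by_contra hUW
    rw [Set.mem_union, not_or] at hUW
    refine h ?_
    have h₁ : x.1 = 0 := by
      by_contra h
      exact hUW.1 (hx.1 h)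
    have h₂ : x.2 = 0 := by
      by_contra h
      exact hUW.2 (hx.2 h)
    simp [h₁, h₂]
  · rw [mem_monomialFamily] at hx
    by_cases h0 : x = 0
    · exact ⟨0, zero_mem _, by simp [h0]⟩
    · rcases hx h0 with h | h
      · refine ⟨(x, 0), AddSubgroup.mem_prod.2 ⟨mem_monomialFamily.2 fun _ => h, zero_mem _⟩, ?_⟩
        simp
      · refine ⟨(0, x), AddSubgroup.mem_prod.2 ⟨zero_mem _, mem_monomialFamily.2 fun _ => h⟩, ?_⟩
        simp

theorem kerFamily_add_prod {Γ : Type*} {U W : Set Γ} :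
    kerFamily (fun a => (monomialFamily K U a).prod (monomialFamily K W a))
      ((LinearMap.fst K K K) + LinearMap.snd K K K) =
      mapFamily (monomialFamily K (U ∩ W)) ((LinearMap.id : K →ₗ[K] K).prod (-LinearMap.id)) := by
  symm
  rw [mapFamily_eq_iff]
  refine ⟨fun a x hx => ?_, ?_⟩
  · rw [mem_monomialFamily] at hx
    refine ⟨AddSubgroup.mem_prod.2 ⟨mem_monomialFamily.2 fun h => (hx h).1,
      mem_monomialFamily.2 fun h => (hx (neg_ne_zero.1 h)).2⟩, ?_⟩
    exact add_neg_cancel x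
  · rintro a ⟨x, y⟩ ⟨h₁, h₂⟩
    have hy : y = -x := (neg_eq_of_add_eq_zero_right h₂).symm
    subst hy
    replace h₁ := AddSubgroup.mem_prod.1 h₁
    rw [mem_monomialFamily, mem_monomialFamily] at h₁
    exact ⟨x, mem_monomialFamily.2 fun h => ⟨h₁.1 h, h₁.2 (neg_ne_zero.2 h)⟩, rfl⟩

theorem Resolved.kerFamily_add (h : (ofPreorder K Γ).Resolved B n r (monomialFamily K (U ∩ W))) :
    (ofPreorder K Γ).Resolved B n r
      (kerFamily (fun a => (monomialFamily K U a).prod (monomialFamily K W a))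
        ((LinearMap.fst K K K) + LinearMap.snd K K K)) := by
  rw [kerFamily_add_prod]
  exact h.map_of_injOn fun a x _ h0 => (Prod.ext_iff.1 h0).1

/-- In 0 → U ∩ W → U ⊕ W → U ∪ W → 0 the last term is a quotient of the middle one. -/
theorem Resolved.union (hU : IsUpperSet U) (hW : IsUpperSet W)
    (h₁ : ∀ n, (ofPreorder K Γ).Resolved B n r (monomialFamily K U))
    (h₂ : ∀ n, (ofPreorder K Γ).Resolved B n r (monomialFamily K W))
    (h₃ : ∀ n, (ofPreorder K Γ).Resolved B n (r + 1) (monomialFamily K (U ∩ W))) (n : ℕ) :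
    (ofPreorder K Γ).Resolved B n r (monomialFamily K (U ∪ W)) := by
  refine Resolved.of_succ ?_
  rw [← mapFamily_add_prod]
  exact Resolved.quotient _ (h₃ n).kerFamily_add
    (Resolved.prod_monomialFamily hU hW (h₁ _) (h₂ _))

/-- Here the intersection is the kernel of the addition map from U ⊕ W onto the sum; the first
projection identifies the antidiagonal copy with the intersection itself. -/
theorem Resolved.inter (hB : Monotone B) (hU : IsUpperSet U) (hW : IsUpperSet W)
    (h₁ : ∀ n, (ofPreorder K Γ).Resolved B n r (monomialFamily K U))
    (h₂ : ∀ n, (ofPreorder K Γ).Resolved B n r (monomialFamily K W))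
    (h₃ : ∀ n, (ofPreorder K Γ).Resolved B n (r - 1) (monomialFamily K (U ∪ W))) (n : ℕ) :
    (ofPreorder K Γ).Resolved B n r (monomialFamily K (U ∩ W)) := by
  have h := Resolved.kernel hB (stable_prod_monomialFamily hU hW)
    ((LinearMap.fst K K K) + LinearMap.snd K K K)
    (Resolved.prod_monomialFamily hU hW (h₁ n) (h₂ n)) (by
      rw [mapFamily_add_prod]
      exact h₃ (n + 1))
  rw [kerFamily_add_prod] at h
  have h' := h.map_of_injOn (f := LinearMap.fst K K K) (by
    rintro a _ ⟨x, -, rfl⟩ h0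
    have hx : x = 0 := h0
    rw [hx]
    exact map_zero _)
  rw [← mapFamily_comp] at h'
  convert h' using 1
  exact (mapFamily_id _).symm

/-- The direct sum U ⊕ W is an extension with U ∩ W as kernel and U ∪ W as image, and U is its
quotient by W. -/
theorem Resolved.left_of_union_of_inter (hU : IsUpperSet U) (hW : IsUpperSet W)
    (h₁ : ∀ n, (ofPreorder K Γ).Resolved B n r (monomialFamily K (U ∪ W)))
    (h₂ : ∀ n, (ofPreorder K Γ).Resolved B n r (monomialFamily K (U ∩ W)))
    (h₃ : ∀ n, (ofPreorder K Γ).Resolved B n (r + 1) (monomialFamily K W)) (n : ℕ) :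
    (ofPreorder K Γ).Resolved B n r (monomialFamily K U) := by
  refine Resolved.of_succ ?_
  rw [← mapFamily_fst_prod (W := W)]
  refine Resolved.quotient _ (h₃ n).kerFamily_fst_prod ?_
  refine Resolved.extension (stable_prod_monomialFamily hU hW)
    ((LinearMap.fst K K K) + LinearMap.snd K K K) (h₂ _).kerFamily_add ?_
  rw [mapFamily_add_prod]
  exact h₁ _

end MayerVietoris

end Preorder

end HomSystem

open HomSystem

/-! ### Regularity bounds for monomial ideals -/

/-- The exponents of degree at most `r`. -/
def degreeLE (V : Type*) (r : ℤ) : Set (V →₀ ℕ) := {b | (b.degree : ℤ) ≤ r}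

theorem mem_degreeLE {V : Type*} {r : ℤ} {b : V →₀ ℕ} :
    b ∈ degreeLE V r ↔ (b.degree : ℤ) ≤ r := Iff.rfl

theorem monotone_degreeLE (V : Type*) : Monotone (degreeLE V) :=
  fun _ _ h _ hb => le_trans (mem_degreeLE.1 hb) h

/-- The monomial ideal with exponent set `U` has multigraded free resolutions, of any prescribed
length, whose generators in homological degree `i` have degree at most `r + i`. -/
def RegLE (K : Type u) [CommRing K] {V : Type v} (r : ℤ) (U : Set (V →₀ ℕ)) : Prop :=
  ∀ n, (ofPreorder K (V →₀ ℕ)).Resolved (degreeLE V) n r (monomialFamily K U)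

namespace RegLE

variable {K : Type u} [CommRing K] {V : Type v} {r r' : ℤ} {U W : Set (V →₀ ℕ)}

theorem mono (h : RegLE K r U) (hr : r ≤ r') : RegLE K r' U :=
  fun n => (h n).mono (monotone_degreeLE V) hr

theorem empty : RegLE K r (∅ : Set (V →₀ ℕ)) := fun n => resolved_monomialFamily_empty n r

theorem Ici {c : V →₀ ℕ} (hc : (c.degree : ℤ) ≤ r) : RegLE K r (Set.Ici c) :=
  fun n => resolved_monomialFamily_Ici hc n

theorem union (hU : IsUpperSet U) (hW : IsUpperSet W) (h₁ : RegLE K r U) (h₂ : RegLE K r W)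
    (h₃ : RegLE K (r + 1) (U ∩ W)) : RegLE K r (U ∪ W) :=
  fun n => Resolved.union hU hW h₁ h₂ h₃ n

theorem inter (hU : IsUpperSet U) (hW : IsUpperSet W) (h₁ : RegLE K r U) (h₂ : RegLE K r W)
    (h₃ : RegLE K (r - 1) (U ∪ W)) : RegLE K r (U ∩ W) :=
  fun n => Resolved.inter (monotone_degreeLE V) hU hW h₁ h₂ h₃ n

theorem left_of_union_of_inter (hU : IsUpperSet U) (hW : IsUpperSet W)
    (h₁ : RegLE K r (U ∪ W)) (h₂ : RegLE K r (U ∩ W)) (h₃ : RegLE K (r + 1) W) : RegLE K r U :=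
  fun n => Resolved.left_of_union_of_inter hU hW h₁ h₂ h₃ n

/-- A generator of degree b becomes one of the truncated degree b - c, which is no larger. -/
theorem colon (h : RegLE K r U) (c : V →₀ ℕ) : RegLE K r {a | a + c ∈ U} := by
  intro n
  have := (h n).pull (B' := degreeLE V) (D := Set.univ) (φ := fun a => a + c) (t := 0) (by
    intro k b hb
    refine Or.inr ⟨b - c, ?_, fun a => by simp [tsub_le_iff_right]⟩
    have h1 : (b - c).degree ≤ b.degree := Finsupp.degree_mono tsub_le_self
    rw [mem_degreeLE] at hb ⊢
    omega)
  rw [pull_monomialFamily] at this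
  simpa using this

/-- Restriction to the variables in `P`: a generator whose degree involves another variable
disappears and the rest stay unchanged. -/
theorem filter (h : RegLE K r U) (P : V → Prop) [DecidablePred P] :
    RegLE K r {a | a.filter P ∈ U} := by
  intro n
  have := (h n).pull (B' := degreeLE V) (D := Set.univ) (φ := fun a => a.filter P) (t := 0) (by
    intro k b hb
    by_cases hP : ∀ v, b v ≠ 0 → P v
    · refine Or.inr ⟨b, by simpa using hb, fun a => ?_⟩
      simp only [Set.mem_univ, true_and, Finsupp.le_def]
      refine forall_congr' fun v => ?_
      by_cases hv : P v
      · rw [Finsupp.filter_apply_pos _ _ hv]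
      · have : b v = 0 := by
          by_contra h
          exact hv (hP v h)
        simp [this]
    · push Not at hP
      obtain ⟨v, hv, hPv⟩ := hP
      refine Or.inl fun a _ hba => hv ?_
      have := Finsupp.le_def.1 hba v
      rwa [Finsupp.filter_apply_neg _ _ hPv, Nat.le_zero] at this)
  rw [pull_monomialFamily] at this
  simpa using this

/-- A generator of degree b moves to the join b ⊔ c, and the join divides the product. -/
theorem inter_Ici (h : RegLE K r U) (c : V →₀ ℕ) : RegLE K (r + c.degree) (U ∩ Set.Ici c) := by
  intro n
  have := (h n).pull (B' := degreeLE V) (D := Set.Ici c) (φ := id) (t := c.degree) (by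
    intro k b hb
    refine Or.inr ⟨b ⊔ c, ?_, fun a => by simp [and_comm]⟩
    have h1 : (b ⊔ c).degree ≤ (b + c).degree :=
      Finsupp.degree_mono (sup_le le_self_add le_add_self)
    rw [map_add] at h1
    rw [mem_degreeLE] at hb ⊢
    omega)
  rw [pull_monomialFamily] at this
  convert this using 2
  ext a
  simp [and_comm]

theorem shift (h : RegLE K r U) (c : V →₀ ℕ) :
    RegLE K (r + c.degree) {a | c ≤ a ∧ a - c ∈ U} := by
  intro n
  have := (h n).pull (B' := degreeLE V) (D := Set.Ici c) (φ := fun a => a - c)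
    (t := c.degree) (by
    intro k b hb
    refine Or.inr ⟨b + c, ?_, fun a => ⟨fun h => ?_, fun h => ⟨?_, ?_⟩⟩⟩
    · rw [mem_degreeLE] at hb ⊢
      rw [map_add]
      push_cast
      omega
    · exact (le_tsub_iff_right h.1).1 h.2
    · exact le_add_self.trans h
    · exact le_tsub_of_add_le_right h)
  rwa [pull_monomialFamily] at this

/-- A colon alone need not lower degrees. Since the ideal lies in (x^c), stripping first makes all
generator degrees multiples of x^c, and division then lowers each by exactly the degree of `c`. -/
theorem unshift {c : V →₀ ℕ} (hc : U ⊆ Set.Ici c) (h : RegLE K (r + c.degree) U) :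
    RegLE K r {a | a + c ∈ U} := by
  intro n
  have h1 := (h n).strip (monotone_degreeLE V) (isUpperSet_Ici c) (fun a ha => by
    rw [eq_bot_iff]
    intro x hx
    rw [mem_monomialFamily] at hx
    by_contra hne
    exact ha (hc (hx hne)))
  have := h1.pull (B' := degreeLE V) (D := Set.univ) (φ := fun a => a + c) (t := -c.degree) (by
    rintro k b ⟨hb, hcb⟩
    refine Or.inr ⟨b - c, ?_, fun a => by simp [tsub_le_iff_right]⟩
    have h1 : (b - c).degree + c.degree = b.degree := by
      rw [← map_add, tsub_add_cancel_of_le hcb]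
    rw [mem_degreeLE] at hb ⊢
    omega)
  rw [pull_monomialFamily] at this
  simpa using this

/-- Mayer–Vietoris: intersecting with the ideal of one variable raises the bound by one, which is
what a sum allows. -/
theorem union_variable (hU : IsUpperSet U) (h : RegLE K r U) (hr : 1 ≤ r) (z : V) :
    RegLE K r (U ∪ Set.Ici (Finsupp.single z 1)) := by
  have hd : (Finsupp.single z 1 : V →₀ ℕ).degree = 1 := by simp
  refine h.union hU (isUpperSet_Ici _) (Ici (by rw [hd]; exact_mod_cast hr)) ?_
  have := h.inter_Ici (Finsupp.single z 1)
  rwa [hd] at this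

theorem union_variables (hU : IsUpperSet U) (h : RegLE K r U) (hr : 1 ≤ r) (Z : Finset V) :
    RegLE K r (U ∪ {a | ∃ z ∈ Z, a z ≠ 0}) := by
  classical
  induction Z using Finset.induction_on with
  | empty => simpa using h
  | insert z Z _ ih =>
    have hup : IsUpperSet (U ∪ {a : V →₀ ℕ | ∃ z ∈ Z, a z ≠ 0}) := by
      refine hU.union ?_
      rintro a b hab ⟨z, hz, ha⟩
      have := Finsupp.le_def.1 hab z
      exact ⟨z, hz, by omega⟩
    convert ih.union_variable hup hr z using 1
    ext a
    simp only [Set.mem_union, Set.mem_ofPred_eq, Finset.mem_insert, Set.mem_Ici,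
      Finsupp.single_le_iff, exists_eq_or_imp, Nat.one_le_iff_ne_zero]
    rw [or_comm (a := a z ≠ 0), or_assoc]

end RegLE

/-! ### Squarefree ideals generated in degree at most two -/

/-- The exponents whose support belongs to `W`. -/
def supportIn {V : Type*} (W : Set (Finset V)) : Set (V →₀ ℕ) := {a | a.support ∈ W}

theorem isUpperSet_supportIn {V : Type*} {W : Set (Finset V)} (hW : IsUpperSet W) :
    IsUpperSet (supportIn W) :=
  fun _ _ hab ha => hW (Finsupp.support_mono hab) ha

section Squarefree

variable {V : Type v} [DecidableEq V]

/-- Every member of `W` contains a member with at most two elements. -/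
def QuadraticallyGenerated (W : Set (Finset V)) : Prop :=
  ∀ A ∈ W, ∃ B ∈ W, B ⊆ A ∧ B.card ≤ 2

theorem support_add_single_one (a : V →₀ ℕ) (x : V) :
    (a + Finsupp.single x 1).support = insert x a.support := by
  ext v
  simp only [Finsupp.mem_support_iff, Finsupp.add_apply, Finset.mem_insert,
    Finsupp.single_apply]
  split_ifs with h
  · simp [h]
  · simp [Ne.symm h]

variable {W : Set (Finset V)}

/-- Take generators inside A ∪ {x} and A ∪ {y}. If one of them lies in A already, it serves for both
colons; otherwise removing x and y leaves at most one element of each, and their union works. -/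
theorem QuadraticallyGenerated.inter_colon (hW : IsUpperSet W) (hq : QuadraticallyGenerated W)
    (x y : V) : QuadraticallyGenerated {A | insert x A ∈ W ∧ insert y A ∈ W} := by
  rintro A ⟨hx, hy⟩
  obtain ⟨B₁, hB₁, hA₁, hc₁⟩ := hq _ hx
  obtain ⟨B₂, hB₂, hA₂, hc₂⟩ := hq _ hy
  by_cases hx₁ : x ∈ B₁
  · by_cases hy₂ : y ∈ B₂
    · refine ⟨B₁.erase x ∪ B₂.erase y, ⟨hW ?_ hB₁, hW ?_ hB₂⟩, ?_, ?_⟩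
      · intro z hz
        by_cases h : z = x <;> simp [h, hz]
      · intro z hz
        by_cases h : z = y <;> simp [h, hz]
      · rw [Finset.subset_insert_iff] at hA₁ hA₂
        exact Finset.union_subset hA₁ hA₂
      · have h₁ := Finset.card_erase_of_mem hx₁
        have h₂ := Finset.card_erase_of_mem hy₂
        have := Finset.card_union_le (B₁.erase x) (B₂.erase y)
        omega
    · exact ⟨B₂, ⟨hW (Finset.subset_insert _ _) hB₂, hW (Finset.subset_insert _ _) hB₂⟩,
        (Finset.subset_insert_iff_of_notMem hy₂).1 hA₂, hc₂⟩
  · exact ⟨B₁, ⟨hW (Finset.subset_insert _ _) hB₁, hW (Finset.subset_insert _ _) hB₁⟩,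
      (Finset.subset_insert_iff_of_notMem hx₁).1 hA₁, hc₁⟩

/-- Once the neighbours `N` of x and y are deleted, xy is the only small generator through x or y.
The restricted ideal is thus H + (xy), where H does not involve x or y. -/
theorem sdiff_mem_iff (hW : IsUpperSet W) (hq : QuadraticallyGenerated W) {x y : V}
    (hxy : {x, y} ∈ W) (hx : {x} ∉ W) (hy : {y} ∉ W) {N : Finset V}
    (hN : ∀ p, p ∈ N ↔ p ≠ x ∧ p ≠ y ∧ ({p, x} ∈ W ∨ {p, y} ∈ W)) (A : Finset V) :
    A \ N ∈ W ↔ A \ (N ∪ {x, y}) ∈ W ∨ (x ∈ A ∧ y ∈ A) := by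
  constructor
  · intro h
    obtain ⟨B, hB, hBA, hc⟩ := hq _ h
    by_contra! hcon
    have key : ∀ z w, ({z} : Finset V) ∉ W → (∀ p ∈ A \ N, {p, z} ∈ W → p = z ∨ p = w) →
        ¬(z ∈ A ∧ w ∈ A) → z ∉ B := by
      intro z w hz hp hzw hzB
      have h1 : B.card ≤ 1 ∨ B.card = 2 := by omega
      rcases h1 with h1 | h1
      · have : B = {z} := by
          ext t
          rw [Finset.mem_singleton]
          exact ⟨fun ht => Finset.card_le_one.1 h1 t ht z hzB, fun ht => ht ▸ hzB⟩
        exact hz (this ▸ hB)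
      · obtain ⟨p, q, hpq, rfl⟩ := Finset.card_eq_two.1 h1
        have hzA : z ∈ A := (Finset.mem_sdiff.1 (hBA hzB)).1
        rcases Finset.mem_insert.1 hzB with rfl | h2
        · have hq' : q ∈ A \ N := hBA (by simp)
          rcases hp q hq' (by rwa [Finset.pair_comm]) with h3 | h3
          · exact hpq h3.symm
          · exact hzw ⟨hzA, h3 ▸ (Finset.mem_sdiff.1 hq').1⟩
        · rw [Finset.mem_singleton] at h2
          subst h2
          have hp' : p ∈ A \ N := hBA (by simp)
          rcases hp p hp' hB with h3 | h3
          · exact hpq h3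
          · exact hzw ⟨hzA, h3 ▸ (Finset.mem_sdiff.1 hp').1⟩
    have hxB : x ∉ B := by
      refine key x y hx (fun p hp hpx => ?_) (fun h => hcon.2 h.1 h.2)
      by_contra! hne
      exact (Finset.mem_sdiff.1 hp).2 ((hN p).2 ⟨hne.1, hne.2, Or.inl hpx⟩)
    have hyB : y ∉ B := by
      refine key y x hy (fun p hp hpy => ?_) (fun h => hcon.2 h.2 h.1)
      by_contra! hne
      exact (Finset.mem_sdiff.1 hp).2 ((hN p).2 ⟨hne.2, hne.1, Or.inr hpy⟩)
    refine hcon.1 (hW ?_ hB)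
    intro t ht
    have := Finset.mem_sdiff.1 (hBA ht)
    simp only [Finset.mem_sdiff, Finset.mem_union, Finset.mem_insert, Finset.mem_singleton]
    refine ⟨this.1, ?_⟩
    rintro (h | rfl | rfl)
    exacts [this.2 h, hxB ht, hyB ht]
  · rintro (h | ⟨h₁, h₂⟩)
    · exact hW (Finset.sdiff_subset_sdiff le_rfl Finset.subset_union_left) h
    · refine hW ?_ hxy
      intro t ht
      rw [Finset.mem_insert, Finset.mem_singleton] at ht
      rw [Finset.mem_sdiff, hN]
      rcases ht with rfl | rfl
      · exact ⟨h₁, fun h => h.1 rfl⟩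
      · exact ⟨h₂, fun h => h.2.1 rfl⟩

/-- In (W : x) + (W : y) the neighbours become variables, and x and y do too because xy is in W. A
further generator avoids all of these, hence belongs to H. -/
theorem insert_mem_or_iff (hW : IsUpperSet W) (hq : QuadraticallyGenerated W) {x y : V}
    (hxy : {x, y} ∈ W) (hx : {x} ∉ W) (hy : {y} ∉ W) {N : Finset V}
    (hN : ∀ p, p ∈ N ↔ p ≠ x ∧ p ≠ y ∧ ({p, x} ∈ W ∨ {p, y} ∈ W)) (A : Finset V) :
    (insert x A ∈ W ∨ insert y A ∈ W) ↔
      A \ (N ∪ {x, y}) ∈ W ∨ ∃ z ∈ N ∪ {x, y}, z ∈ A := by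
  constructor
  · intro h
    by_contra! hcon
    have hA : A \ (N ∪ {x, y}) = A :=
      Finset.sdiff_eq_self_of_disjoint (Finset.disjoint_left.2 fun z hz hz' => hcon.2 z hz' hz)
    have hAW : A ∉ W := hA ▸ hcon.1
    have hxA : x ∉ A := hcon.2 x (by simp)
    have hyA : y ∉ A := hcon.2 y (by simp)
    have hAN : A \ N = A := Finset.sdiff_eq_self_of_disjoint
      (Finset.disjoint_left.2 fun z hz hz' => hcon.2 z (Finset.mem_union_left _ hz') hz)
    have hins : ∀ z, z ∉ N → (z = x ∨ z = y) → insert z A ∉ W := by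
      intro z hzN hz hmem
      have h1 : insert z A \ N ∈ W := by
        rwa [Finset.insert_sdiff_of_notMem _ hzN, hAN]
      rcases (sdiff_mem_iff hW hq hxy hx hy hN _).1 h1 with h2 | h2
      · refine hAW (hW ?_ h2)
        intro t ht
        simp only [Finset.mem_sdiff, Finset.mem_insert, Finset.mem_union,
          Finset.mem_singleton] at ht
        rcases ht.1 with rfl | h
        · exact absurd (Or.inr hz) ht.2
        · exact h
      · have hne : x ≠ y := by
          rintro rfl
          exact hx (by simpa using hxy)
        rw [Finset.mem_insert, Finset.mem_insert] at h2
        rcases hz with rfl | rfl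
        · exact h2.2.elim (fun h => hne h.symm) hyA
        · exact h2.1.elim hne hxA
    rcases h with h | h
    · exact hins x (fun h => ((hN x).1 h).1 rfl) (Or.inl rfl) h
    · exact hins y (fun h => ((hN y).1 h).2.1 rfl) (Or.inr rfl) h
  · rintro (h | ⟨z, hz, hzA⟩)
    · exact Or.inl (hW (Finset.sdiff_subset.trans (Finset.subset_insert _ _)) h)
    · simp only [Finset.mem_union, hN, Finset.mem_insert, Finset.mem_singleton] at hz
      rcases hz with ⟨-, -, h | h⟩ | rfl | rfl
      · refine Or.inl (hW ?_ h)
        intro t ht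
        simp only [Finset.mem_insert, Finset.mem_singleton] at ht ⊢
        rcases ht with rfl | rfl
        exacts [Or.inr hzA, Or.inl rfl]
      · refine Or.inr (hW ?_ h)
        intro t ht
        simp only [Finset.mem_insert, Finset.mem_singleton] at ht ⊢
        rcases ht with rfl | rfl
        exacts [Or.inr hzA, Or.inl rfl]
      · refine Or.inr (hW ?_ hxy)
        intro t ht
        simp only [Finset.mem_insert, Finset.mem_singleton] at ht ⊢
        rcases ht with rfl | rfl
        exacts [Or.inr hzA, Or.inl rfl]
      · refine Or.inl (hW ?_ hxy)
        intro t ht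
        simp only [Finset.mem_insert, Finset.mem_singleton] at ht ⊢
        rcases ht with rfl | rfl
        exacts [Or.inl rfl, Or.inr hzA]

theorem supportIn_insert (x : V) :
    supportIn {A | insert x A ∈ W} = {a | a + Finsupp.single x 1 ∈ supportIn W} := by
  ext a
  simp only [supportIn, Set.mem_ofPred_eq, support_add_single_one]

theorem supportIn_sdiff (N : Finset V) :
    supportIn {A | A \ N ∈ W} = {a | a.filter (· ∉ N) ∈ supportIn W} := by
  ext a
  simp only [supportIn, Set.mem_ofPred_eq, Finsupp.support_filter, Finset.filter_notMem_eq_sdiff]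

theorem isUpperSet_insert_mem (hW : IsUpperSet W) (x : V) :
    IsUpperSet {A : Finset V | insert x A ∈ W} :=
  fun _ _ h hA => hW (Finset.insert_subset_insert _ h) hA

theorem isUpperSet_sdiff_mem (hW : IsUpperSet W) (N : Finset V) :
    IsUpperSet {A : Finset V | A \ N ∈ W} :=
  fun _ _ h hA => hW (Finset.sdiff_subset_sdiff h le_rfl) hA

/-- Colons by a variable keep the bound r, so by Mayer–Vietoris it is enough to bound the sum of the
two colons by r - 1. That sum is H plus variables, and the gain of one comes from the two disjoint
pieces of the restriction H + (xy). -/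
theorem RegLE.inter_colon [Finite V] {K : Type u} [CommRing K] {r : ℤ} (hr : 2 ≤ r)
    (hW : IsUpperSet W) (hq : QuadraticallyGenerated W) {x y : V} (hxy : {x, y} ∈ W)
    (h : RegLE K r (supportIn W)) :
    RegLE K r (supportIn {A | insert x A ∈ W ∧ insert y A ∈ W}) := by
  classical
  cases nonempty_fintype V
  have hcol : ∀ z, RegLE K r (supportIn {A | insert z A ∈ W}) := fun z => by
    rw [supportIn_insert]
    exact h.colon _
  have hins : ∀ z, {z} ∈ W → ∀ A, insert z A ∈ W := fun z hz A =>
    hW (Finset.singleton_subset_iff.2 (Finset.mem_insert_self z A)) hz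
  by_cases hx : {x} ∈ W
  · simpa only [hins x hx, true_and] using hcol y
  by_cases hy : {y} ∈ W
  · simpa only [hins y hy, and_true] using hcol x
  let N : Finset V := Finset.univ.filter
    fun p => p ≠ x ∧ p ≠ y ∧ ({p, x} ∈ W ∨ {p, y} ∈ W)
  have hN : ∀ p, p ∈ N ↔ p ≠ x ∧ p ≠ y ∧ ({p, x} ∈ W ∨ {p, y} ∈ W) := fun p => by simp [N]
  have hne : x ≠ y := by
    rintro rfl
    exact hx (by simpa using hxy)
  set c : V →₀ ℕ := Finsupp.single x 1 + Finsupp.single y 1 with hc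
  have hdc : c.degree = 2 := by simp [hc]
  have hci : ∀ a : V →₀ ℕ, c ≤ a ↔ x ∈ a.support ∧ y ∈ a.support := by
    intro a
    rw [Finsupp.mem_support_iff, Finsupp.mem_support_iff]
    constructor
    · intro hca
      have h₁ := Finsupp.le_def.1 hca x
      have h₂ := Finsupp.le_def.1 hca y
      simp only [hc, Finsupp.add_apply, Finsupp.single_eq_same] at h₁ h₂
      omega
    · rintro ⟨h₁, h₂⟩
      rw [Finsupp.le_def]
      intro v
      simp only [hc, Finsupp.add_apply, Finsupp.single_apply]
      split_ifs with h3 h4 h4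
      · exact absurd (h3.trans h4.symm) hne
      · subst h3
        omega
      · subst h4
        omega
      · omega
  set H := supportIn {A | A \ (N ∪ {x, y}) ∈ W} with hH
  have hHu : IsUpperSet H := isUpperSet_supportIn (isUpperSet_sdiff_mem hW _)
  have hHr : RegLE K r H := by
    rw [hH, supportIn_sdiff]
    exact h.filter _
  have hH'r : RegLE K r (H ∪ Set.Ici c) := by
    have : H ∪ Set.Ici c = supportIn {A | A \ N ∈ W} := by
      ext a
      simp only [supportIn, Set.mem_ofPred_eq, Set.mem_union, Set.mem_Ici, hH, hci,
        sdiff_mem_iff hW hq hxy hx hy hN]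
    rw [this, supportIn_sdiff]
    exact h.filter _
  -- Both H and H + (xy) are restrictions of W, so they have bound r; Mayer–Vietoris gives r + 1 =
  -- (r - 1) + 2 for the intersection.
  have hHc : RegLE K (r - 1 + c.degree) (H ∩ Set.Ici c) := by
    refine RegLE.inter hHu (isUpperSet_Ici c) (hHr.mono (by omega)) (RegLE.Ici (by omega)) ?_
    exact hH'r.mono (by omega)
  -- As x and y do not occur in H, the intersection of H and (xy) is xy H, and dividing by xy lowers
  -- the bound by two.
  have hHr' : RegLE K (r - 1) H := by
    convert hHc.unshift Set.inter_subset_right using 1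
    ext a
    simp only [Set.mem_ofPred_eq, Set.mem_inter_iff, Set.mem_Ici, le_add_iff_nonneg_left, zero_le,
      and_true]
    simp only [hH, supportIn, hc, ← add_assoc, Set.mem_ofPred_eq, support_add_single_one]
    have : insert y (insert x a.support) \ (N ∪ {x, y}) = a.support \ (N ∪ {x, y}) := by
      rw [Finset.insert_sdiff_of_mem _ (by simp), Finset.insert_sdiff_of_mem _ (by simp)]
    rw [this]
  -- Adding variables requires 1 ≤ r - 1, which is where 2 ≤ r enters.
  have hun : RegLE K (r - 1) (supportIn {A | insert x A ∈ W} ∪ supportIn {A | insert y A ∈ W}) := by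
    convert hHr'.union_variables hHu (by omega) (N ∪ {x, y}) using 1
    ext a
    have := insert_mem_or_iff hW hq hxy hx hy hN a.support
    simpa only [supportIn, Set.mem_union, Set.mem_ofPred_eq, hH, Finsupp.mem_support_iff] using this
  exact RegLE.inter (isUpperSet_supportIn (isUpperSet_insert_mem hW x))
    (isUpperSet_supportIn (isUpperSet_insert_mem hW y)) (hcol x) (hcol y) hun

end Squarefree

/-! ### The exchange property of products of ideals generated by variables -/

section Exchange

variable {V : Type*} [DecidableEq V]

/-- Exchange property of a product of ideals generated by variables: the triples `(w, p, q)` encode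
two products of variables `∏ p` and `∏ q`, where `p` and `q` belong to the factor of `w`. -/
theorem Multiset.exists_exchange (R : V → V → Prop) (t : Multiset (V × V × V))
    (hR : ∀ x ∈ t, R x.1 x.2.1 ∧ R x.1 x.2.2) (a : V)
    (ha : (t.map fun x => x.2.2).count a < (t.map fun x => x.2.1).count a) :
    ∃ b, (t.map fun x => x.2.1).count b < (t.map fun x => x.2.2).count b ∧
      ∃ t' : Multiset (V × V), t'.map Prod.fst = t.map Prod.fst ∧ (∀ x ∈ t', R x.1 x.2) ∧
        b ::ₘ t'.map Prod.snd = a ::ₘ t.map fun x => x.2.2 := by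
  induction hn : t.card generalizing t a with
  | zero =>
    rw [Multiset.card_eq_zero] at hn
    simp [hn] at ha
  | succ n ih =>
    obtain ⟨⟨w, p, c⟩, hx, rfl⟩ : ∃ x ∈ t, x.2.1 = a :=
      Multiset.mem_map.1 (Multiset.count_pos.1 (Nat.zero_lt_of_lt ha))
    obtain ⟨t, rfl⟩ := Multiset.exists_cons_of_mem hx
    have hR₀ := hR _ hx
    have hR₁ : ∀ x ∈ t, R x.1 x.2.1 ∧ R x.1 x.2.2 := fun x hx => hR x (Multiset.mem_cons_of_mem hx)
    rw [Multiset.card_cons, Nat.succ_inj] at hn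
    -- Trade c for p in the factor of w. If c occurs more often in the second product, it is the
    -- variable to remove. Otherwise c is in excess in the first product of the remaining triples,
    -- and induction puts c back in exchange for some b.
    by_cases hc : (((w, p, c) ::ₘ t).map fun x => x.2.1).count c <
        (((w, p, c) ::ₘ t).map fun x => x.2.2).count c
    · refine ⟨c, hc, (w, p) ::ₘ t.map fun x => (x.1, x.2.2), by simp, ?_, ?_⟩
      · intro x hx
        rcases Multiset.mem_cons.1 hx with rfl | hx
        · exact hR₀.1
        · obtain ⟨y, hy, rfl⟩ := Multiset.mem_map.1 hx
          exact (hR₁ y hy).2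
      · simp [Multiset.cons_swap c p]
    · simp only [Multiset.map_cons, Multiset.count_cons] at ha hc
      obtain ⟨b, hb, t', ht', hR', heq⟩ := ih t hR₁ c (by
        by_cases h : c = p
        · subst h
          simp only [if_true] at ha
          omega
        · simp only [h, if_true, if_false] at hc
          omega) hn
      refine ⟨b, ?_, (w, p) ::ₘ t', by simp [ht'], ?_, ?_⟩
      · simp only [Multiset.map_cons, Multiset.count_cons]
        by_cases h : b = p
        · subst h
          simp only [if_true] at ha ⊢
          omega
        · simp only [h, if_false]
          omega
      · intro x hx
        rcases Multiset.mem_cons.1 hx with rfl | hx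
        · exact hR₀.1
        · exact hR' x hx
      · simp only [Multiset.map_cons]
        rw [Multiset.cons_swap, heq]

theorem Multiset.exists_triples {V : Type*} {l l' : Multiset (V × V)}
    (h : l'.map Prod.fst = l.map Prod.fst) :
    ∃ t : Multiset (V × V × V), t.map (fun x => (x.1, x.2.1)) = l' ∧
      t.map (fun x => (x.1, x.2.2)) = l := by
  rw [← Multiset.rel_eq, Multiset.rel_map] at h
  induction h with
  | zero => exact ⟨0, rfl, rfl⟩
  | @cons a b as bs hab _ ih =>
    obtain ⟨t, rfl, rfl⟩ := ih
    refine ⟨(a.1, a.2, b.2) ::ₘ t, by simp, ?_⟩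
    rw [Multiset.map_cons, hab]

end Exchange

/-! ### Vertex covers, symbolic powers and lexicographic colons -/

section Covers

variable {V : Type v}

/-- The exponent of the product of the edges in `l`. -/
noncomputable def edgeSum (l : Multiset (V × V)) : V →₀ ℕ :=
  (l.map fun p => Finsupp.single p.1 1 + Finsupp.single p.2 1).sum

theorem edgeSum_cons (p : V × V) (l : Multiset (V × V)) :
    edgeSum (p ::ₘ l) = Finsupp.single p.1 1 + Finsupp.single p.2 1 + edgeSum l := by
  simp [edgeSum]

theorem degree_edgeSum (l : Multiset (V × V)) : (edgeSum l).degree = 2 * l.card := by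
  induction l using Multiset.induction_on with
  | empty => simp [edgeSum]
  | cons p l ih =>
    rw [edgeSum_cons, map_add, map_add, ih, Finsupp.degree_single, Finsupp.degree_single,
      Multiset.card_cons]
    ring

theorem edgeSum_apply [DecidableEq V] (l : Multiset (V × V)) (v : V) :
    edgeSum l v = (l.map Prod.fst).count v + (l.map Prod.snd).count v := by
  induction l using Multiset.induction_on with
  | empty => simp [edgeSum]
  | cons p l ih =>
    simp only [edgeSum_cons, Finsupp.add_apply, ih, Multiset.map_cons, Multiset.count_cons,
      Finsupp.single_apply, eq_comm (a := v)]
    ring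

namespace SimpleGraph

variable (G : SimpleGraph V)

/-- Minimal vertex covers. -/
def IsMinimalCover (C : Finset V) : Prop := Minimal (fun C : Finset V => G.IsVertexCover ↑C) C

/-- The exponents of the monomials in the `t`-th symbolic power of the edge ideal. -/
def symbolicExponents (t : ℕ) : Set (V →₀ ℕ) :=
  {a | ∀ C, G.IsMinimalCover C → t ≤ ∑ v ∈ C, a v}

/-- The exponents of the monomials in the edge ideal. -/
def edgeExponents : Set (V →₀ ℕ) := {a | ∃ v w, G.Adj v w ∧ a v ≠ 0 ∧ a w ≠ 0}

/-- The exponents of the products of `s` edges. -/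
def edgeProducts (s : ℕ) : Set (V →₀ ℕ) :=
  {m | ∃ l : Multiset (V × V), l.card = s ∧ (∀ p ∈ l, G.Adj p.1 p.2) ∧ edgeSum l = m}

/-- The exponents of the monomials in the `s`-th power of the edge ideal. -/
def powerExponents (s : ℕ) : Set (V →₀ ℕ) := {a | ∃ m ∈ G.edgeProducts s, m ≤ a}

/-- The sets of vertices that meet all minimal vertex covers that contain just one vertex of each
edge in `l`. -/
def transversals (l : Multiset (V × V)) : Set (Finset V) :=
  {A | ∀ C, G.IsMinimalCover C → (∀ p ∈ l, ¬(p.1 ∈ C ∧ p.2 ∈ C)) → ∃ v ∈ A, v ∈ C}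

variable {G}

theorem isUpperSet_symbolicExponents (t : ℕ) : IsUpperSet (G.symbolicExponents t) :=
  fun _ _ h ha C hC => (ha C hC).trans (Finset.sum_le_sum fun v _ => Finsupp.le_def.1 h v)

theorem isUpperSet_powerExponents (s : ℕ) : IsUpperSet (G.powerExponents s) :=
  fun _ _ h ⟨m, hm, hma⟩ => ⟨m, hm, hma.trans h⟩

theorem isUpperSet_edgeExponents : IsUpperSet G.edgeExponents := by
  rintro a b h ⟨v, w, hvw, hv, hw⟩
  have h₁ := Finsupp.le_def.1 h v
  have h₂ := Finsupp.le_def.1 h w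
  exact ⟨v, w, hvw, by omega, by omega⟩

theorem isUpperSet_transversals (l : Multiset (V × V)) : IsUpperSet (G.transversals l) := by
  intro A B h hA C hC hl
  obtain ⟨v, hv, hvC⟩ := hA C hC hl
  exact ⟨v, h hv, hvC⟩

theorem exists_isMinimalCover_subset {C : Finset V} (hC : G.IsVertexCover ↑C) :
    ∃ D ⊆ C, G.IsMinimalCover D := by
  classical
  obtain ⟨D, hDC, hD⟩ :=
    exists_minimal_le_of_wellFoundedLT (fun C : Finset V => G.IsVertexCover ↑C) C hC
  exact ⟨D, hDC, hD⟩

/-- Every edge has one or two ends in a cover, so the sum exceeds the number of edges by the number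
of edges with both ends in C. -/
theorem sum_edgeSum {C : Finset V} (hC : G.IsVertexCover ↑C) {l : Multiset (V × V)}
    (hl : ∀ p ∈ l, G.Adj p.1 p.2) : l.card ≤ ∑ v ∈ C, edgeSum l v ∧
      (∑ v ∈ C, edgeSum l v ≤ l.card ↔ ∀ p ∈ l, ¬(p.1 ∈ C ∧ p.2 ∈ C)) := by
  classical
  induction l using Multiset.induction_on with
  | empty => simp [edgeSum]
  | cons p l ih =>
    obtain ⟨h₁, h₂⟩ := ih fun q hq => hl q (Multiset.mem_cons_of_mem hq)
    have hp := hC (hl p (Multiset.mem_cons_self p l))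
    simp only [Finset.mem_coe] at hp
    have hs : ∑ v ∈ C, edgeSum (p ::ₘ l) v = (if p.1 ∈ C then 1 else 0) +
        (if p.2 ∈ C then 1 else 0) + ∑ v ∈ C, edgeSum l v := by
      simp [edgeSum_cons, Finset.sum_add_distrib, Finsupp.single_apply]
    rw [hs, Multiset.card_cons]
    simp only [Multiset.mem_cons, forall_eq_or_imp]
    rw [← h₂]
    by_cases c₁ : p.1 ∈ C <;> by_cases c₂ : p.2 ∈ C <;> simp only [c₁, c₂, if_true, if_false]
    · refine ⟨by omega, ⟨fun h => by omega, fun h => absurd trivial (by simpa using h.1)⟩⟩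
    · refine ⟨by omega, ⟨fun h => ⟨by simp, by omega⟩, fun h => by omega⟩⟩
    · refine ⟨by omega, ⟨fun h => ⟨by simp, by omega⟩, fun h => by omega⟩⟩
    · simp [c₁, c₂] at hp

theorem sum_pos_iff {C : Finset V} {a : V →₀ ℕ} :
    1 ≤ ∑ v ∈ C, a v ↔ ∃ v ∈ a.support, v ∈ C := by
  rw [Nat.one_le_iff_ne_zero, Ne, Finset.sum_eq_zero_iff]
  push Not
  exact ⟨fun ⟨v, h, h'⟩ => ⟨v, Finsupp.mem_support_iff.2 h', h⟩,
    fun ⟨v, h, h'⟩ => ⟨v, h', Finsupp.mem_support_iff.1 h⟩⟩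

/-- The colon of a symbolic power by a product of edges. -/
theorem add_edgeSum_mem_symbolicExponents {l : Multiset (V × V)} (hl : ∀ p ∈ l, G.Adj p.1 p.2)
    (a : V →₀ ℕ) : a + edgeSum l ∈ G.symbolicExponents (l.card + 1) ↔
      a ∈ supportIn (G.transversals l) := by
  refine forall_congr' fun C => forall_congr' fun hC => ?_
  obtain ⟨h₁, h₂⟩ := sum_edgeSum hC.1 hl
  rw [← h₂, ← sum_pos_iff]
  simp only [Finsupp.add_apply, Finset.sum_add_distrib]
  omega

/-- A cover that omits an end of p cannot be met in that end, so meeting it after adjoining either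
end means that A meets it. This identity drives the induction over edges. -/
theorem transversals_cons [DecidableEq V] (p : V × V) (l : Multiset (V × V)) :
    G.transversals (p ::ₘ l) =
      {A | insert p.1 A ∈ G.transversals l ∧ insert p.2 A ∈ G.transversals l} := by
  ext A
  constructor
  · intro h
    have key : ∀ C, G.IsMinimalCover C → (∀ p ∈ l, ¬(p.1 ∈ C ∧ p.2 ∈ C)) →
        (p.1 ∈ C ∧ p.2 ∈ C) ∨ ∃ v ∈ A, v ∈ C := by
      intro C hC hl
      by_cases hp : p.1 ∈ C ∧ p.2 ∈ C
      · exact Or.inl hp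
      · refine Or.inr (h C hC fun q hq => ?_)
        rcases Multiset.mem_cons.1 hq with rfl | hq
        exacts [hp, hl q hq]
    constructor <;>
    · intro C hC hl
      rcases key C hC hl with hp | ⟨v, hv, hvC⟩
      · first
          | exact ⟨_, Finset.mem_insert_self p.1 A, hp.1⟩
          | exact ⟨_, Finset.mem_insert_self p.2 A, hp.2⟩
      · exact ⟨v, Finset.mem_insert_of_mem hv, hvC⟩
  · rintro ⟨h₁, h₂⟩ C hC hl
    have hl' : ∀ q ∈ l, ¬(q.1 ∈ C ∧ q.2 ∈ C) := fun q hq => hl q (Multiset.mem_cons_of_mem hq)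
    obtain ⟨v, hv, hvC⟩ := h₁ C hC hl'
    obtain ⟨w, hw, hwC⟩ := h₂ C hC hl'
    rcases Finset.mem_insert.1 hv with rfl | hv
    · rcases Finset.mem_insert.1 hw with rfl | hw
      · exact absurd ⟨hvC, hwC⟩ (hl p (Multiset.mem_cons_self _ _))
      · exact ⟨w, hw, hwC⟩
    · exact ⟨v, hv, hvC⟩

theorem pair_mem_transversals [DecidableEq V] {x y : V} (h : G.Adj x y) (l : Multiset (V × V)) :
    {x, y} ∈ G.transversals l := by
  intro C hC _
  rcases hC.1 h with h | h
  exacts [⟨x, by simp, h⟩, ⟨y, by simp, h⟩]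

theorem exists_oriented [DecidableEq V] {C : Finset V} (hC : G.IsVertexCover ↑C)
    {l : Multiset (V × V)} (hl : ∀ p ∈ l, G.Adj p.1 p.2)
    (hlC : ∀ p ∈ l, ¬(p.1 ∈ C ∧ p.2 ∈ C)) :
    ∃ l' : Multiset (V × V), l'.card = l.card ∧ edgeSum l' = edgeSum l ∧
      ∀ p ∈ l', (G.Adj p.1 p.2 ∧ p.2 ∉ C) ∧ p.1 ∈ C := by
  refine ⟨l.map fun p => if p.1 ∈ C then p else p.swap, by simp, ?_, ?_⟩
  · simp only [edgeSum, Multiset.map_map, Function.comp_apply]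
    congr 1
    refine Multiset.map_congr rfl fun p _ => ?_
    split_ifs
    · rfl
    · exact add_comm _ _
  · intro p hp
    obtain ⟨q, hq, rfl⟩ := Multiset.mem_map.1 hp
    have hadj := hl q hq
    split_ifs with h
    · exact ⟨⟨hadj, fun h' => hlC q hq ⟨h, h'⟩⟩, h⟩
    · exact ⟨⟨hadj.symm, h⟩, (hC hadj).resolve_left h⟩

/-- Orient all edges with first end in C and second end outside. Agreement on C gives both products
the same first ends, so the edges match in triples (w, p, q) with p and q adjacent to w; exchange
acts on the second ends. -/
theorem exists_edgeProducts_exchange [DecidableEq V] {C : Finset V} (hC : G.IsVertexCover ↑C)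
    {l l' : Multiset (V × V)} (hl : ∀ p ∈ l, G.Adj p.1 p.2)
    (hl' : ∀ p ∈ l', G.Adj p.1 p.2) (hlC : ∀ p ∈ l, ¬(p.1 ∈ C ∧ p.2 ∈ C))
    (hlC' : ∀ p ∈ l', ¬(p.1 ∈ C ∧ p.2 ∈ C)) (heq : ∀ v ∈ C, edgeSum l' v = edgeSum l v) {z : V}
    (hz : edgeSum l z < edgeSum l' z) :
    ∃ w, edgeSum l' w < edgeSum l w ∧
      ∃ m ∈ G.edgeProducts l.card, m + Finsupp.single w 1 = edgeSum l + Finsupp.single z 1 := by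
  obtain ⟨k, hk, hkl, hkC⟩ := exists_oriented hC hl hlC
  obtain ⟨k', hk', hkl', hkC'⟩ := exists_oriented hC hl' hlC'
  simp only [← hkl, ← hkl'] at heq hz ⊢
  rw [← hk]
  have hfst : ∀ k : Multiset (V × V), (∀ p ∈ k, (G.Adj p.1 p.2 ∧ p.2 ∉ C) ∧ p.1 ∈ C) →
      (∀ v ∈ C, (k.map Prod.fst).count v = edgeSum k v) ∧
      ∀ v ∉ C, (k.map Prod.fst).count v = 0 := by
    intro k hk
    refine ⟨fun v hv => ?_, fun v hv => ?_⟩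
    · rw [edgeSum_apply, Multiset.count_eq_zero_of_notMem (s := k.map Prod.snd), add_zero]
      intro h
      obtain ⟨p, hp, rfl⟩ := Multiset.mem_map.1 h
      exact (hk p hp).1.2 hv
    · rw [Multiset.count_eq_zero]
      intro h
      obtain ⟨p, hp, rfl⟩ := Multiset.mem_map.1 h
      exact hv (hk p hp).2
  have hmap : k'.map Prod.fst = k.map Prod.fst := by
    ext v
    by_cases hv : v ∈ C
    · rw [(hfst k hkC).1 v hv, (hfst k' hkC').1 v hv, heq v hv]
    · rw [(hfst k hkC).2 v hv, (hfst k' hkC').2 v hv]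
  obtain ⟨t, rfl, rfl⟩ := Multiset.exists_triples hmap
  rw [edgeSum_apply, edgeSum_apply, hmap, Nat.add_lt_add_iff_left, Multiset.map_map,
    Multiset.map_map] at hz
  obtain ⟨w, hw, t', ht', hR, hcons⟩ := Multiset.exists_exchange (fun x y => G.Adj x y) t
    (fun x hx => ⟨(hkC' _ (Multiset.mem_map_of_mem _ hx)).1.1,
      (hkC _ (Multiset.mem_map_of_mem _ hx)).1.1⟩) z hz
  refine ⟨w, ?_, edgeSum t', ⟨t', ?_, hR, rfl⟩, ?_⟩
  · rw [edgeSum_apply, edgeSum_apply, hmap, Nat.add_lt_add_iff_left, Multiset.map_map,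
      Multiset.map_map]
    exact hw
  · have := congrArg Multiset.card ht'
    simpa using this
  · ext v
    have h₁ := congrArg (Multiset.count v) hcons
    rw [Multiset.count_cons, Multiset.count_cons] at h₁
    rw [Finsupp.add_apply, Finsupp.add_apply, edgeSum_apply, edgeSum_apply, ht', Multiset.map_map,
      Multiset.map_map, Finsupp.single_apply, Finsupp.single_apply]
    simp only [eq_comm (a := v)] at h₁
    have h₂ : t.map (Prod.fst ∘ fun x => (x.1, x.2.2)) = t.map Prod.fst := rfl
    rw [h₂]
    simp only [Function.comp_def]
    omega

/-- The colon ideals that arise when the products of `s` edges are added in lexicographic order to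
the symbolic power differ from those of the symbolic power by variables only. -/
theorem add_edgeSum_mem_union_iff [LinearOrder V] {l : Multiset (V × V)}
    (hl : ∀ p ∈ l, G.Adj p.1 p.2) {S : Set (V →₀ ℕ)}
    (hS : ∀ m, m ∈ S ↔ m ∈ G.edgeProducts l.card ∧ toLex (edgeSum l) < toLex m) {Z : Finset V}
    (hZ : ∀ z, z ∈ Z ↔ Finsupp.single z 1 + edgeSum l ∈
      G.symbolicExponents (l.card + 1) ∪ {a | ∃ m ∈ S, m ≤ a}) (a : V →₀ ℕ) :
    a + edgeSum l ∈ G.symbolicExponents (l.card + 1) ∪ {a | ∃ m ∈ S, m ≤ a} ↔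
      a ∈ supportIn (G.transversals l) ∪ {a | ∃ z ∈ Z, a z ≠ 0} := by
  have hup : IsUpperSet (G.symbolicExponents (l.card + 1) ∪ {a | ∃ m ∈ S, m ≤ a}) :=
    (isUpperSet_symbolicExponents _).union fun _ _ h ⟨m, hm, hma⟩ => ⟨m, hm, hma.trans h⟩
  constructor
  · rintro (h | ⟨m, hm, hma⟩)
    · exact Or.inl ((add_edgeSum_mem_symbolicExponents hl a).1 h)
    · rw [Set.mem_union]
      by_contra! hcon
      have hnot : a + edgeSum l ∉ G.symbolicExponents (l.card + 1) := fun h =>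
        hcon.1 ((add_edgeSum_mem_symbolicExponents hl a).1 h)
      simp only [symbolicExponents, Set.mem_ofPred_eq, not_forall, not_le] at hnot
      obtain ⟨C, hC, hlt⟩ := hnot
      obtain ⟨⟨l', hl'c, hl', rfl⟩, hlex⟩ := (hS m).1 hm
      obtain ⟨h₁, h₂⟩ := sum_edgeSum hC.1 hl
      obtain ⟨h₁', h₂'⟩ := sum_edgeSum hC.1 hl'
      simp only [Finsupp.add_apply, Finset.sum_add_distrib] at hlt
      have hsum : ∑ v ∈ C, edgeSum l' v ≤ ∑ v ∈ C, (a + edgeSum l) v :=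
        Finset.sum_le_sum fun v _ => Finsupp.le_def.1 hma v
      simp only [Finsupp.add_apply, Finset.sum_add_distrib] at hsum
      -- Over C the exponent a + m sums to at most s, whereas m and m' each sum to at least s. All
      -- inequalities are therefore equalities.
      have ha0 : ∀ v ∈ C, a v = 0 := by
        rw [← Finset.sum_eq_zero_iff]
        omega
      have hle : ∀ v ∈ C, edgeSum l' v ≤ edgeSum l v := fun v hv => by
        have := Finsupp.le_def.1 hma v
        rwa [Finsupp.add_apply, ha0 v hv, zero_add] at this
      have heq : ∀ v ∈ C, edgeSum l' v = edgeSum l v :=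
        (Finset.sum_eq_sum_iff_of_le hle).1 (by omega)
      obtain ⟨z, hz, hzlt⟩ := Finsupp.Lex.lt_iff.1 hlex
      obtain ⟨w, hw, m, hm, hmw⟩ := exists_edgeProducts_exchange hC.1 hl hl'
        (h₂.1 (by omega)) (h₂'.1 (by omega)) heq hzlt
      -- The two products agree before z, so w comes after z and trading w for z makes m
      -- lexicographically larger.
      have hzw : z < w := by
        rcases lt_trichotomy z w with h | h | h
        · exact h
        · subst h
          exact absurd hw (by exact hzlt.asymm)
        · exact absurd (hz w h) (by exact hw.ne')
      have hmS : m ∈ S := by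
        refine (hS m).2 ⟨hm, Finsupp.Lex.lt_iff.2 ⟨z, fun v hv => ?_, ?_⟩⟩
        · have := DFunLike.congr_fun hmw v
          rw [Finsupp.add_apply, Finsupp.add_apply, Finsupp.single_eq_of_ne (hv.trans hzw).ne,
            Finsupp.single_eq_of_ne hv.ne] at this
          exact this.symm
        · have := DFunLike.congr_fun hmw z
          rw [Finsupp.add_apply, Finsupp.add_apply, Finsupp.single_eq_of_ne hzw.ne,
            Finsupp.single_eq_same] at this
          change edgeSum l z < m z
          omega
      have hzZ : z ∈ Z := by
        refine (hZ z).2 (Or.inr ⟨m, hmS, ?_⟩)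
        rw [add_comm, ← hmw]
        exact le_self_add
      -- The variable z divides x^a because m' has more of z than m and divides x^a m.
      refine hcon.2 ⟨z, hzZ, fun h0 => ?_⟩
      have := Finsupp.le_def.1 hma z
      rw [Finsupp.add_apply, h0, zero_add] at this
      exact absurd hzlt (not_lt.2 this)
  · rintro (h | ⟨z, hz, haz⟩)
    · exact Or.inl ((add_edgeSum_mem_symbolicExponents hl a).2 h)
    · refine hup ?_ ((hZ z).1 hz)
      gcongr
      rw [Finsupp.single_le_iff]
      omega

variable [Finite V]

/-- If A contains no edge, its complement is a cover, and a minimal cover inside the complement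
misses A. -/
theorem mem_transversals_zero_iff {A : Finset V} :
    A ∈ G.transversals 0 ↔ ∃ v ∈ A, ∃ w ∈ A, G.Adj v w := by
  classical
  cases nonempty_fintype V
  constructor
  · intro h
    by_contra! hcon
    obtain ⟨D, hD, hDm⟩ := exists_isMinimalCover_subset (G := G) (C := Aᶜ) (by
      intro v w hvw
      simp only [Finset.coe_compl, Set.mem_compl_iff, Finset.mem_coe]
      by_contra! hc
      exact hcon v hc.1 w hc.2 hvw)
    obtain ⟨v, hv, hvD⟩ := h D hDm (by simp)
    exact Finset.mem_compl.1 (hD hvD) hv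
  · rintro ⟨v, hv, w, hw, h⟩ C hC -
    rcases hC.1 h with h | h
    exacts [⟨v, hv, h⟩, ⟨w, hw, h⟩]

theorem supportIn_transversals_zero : supportIn (G.transversals 0) = G.edgeExponents := by
  ext a
  simp only [supportIn, Set.mem_ofPred_eq, mem_transversals_zero_iff, edgeExponents,
    Finsupp.mem_support_iff]
  exact ⟨fun ⟨v, hv, w, hw, h⟩ => ⟨v, w, h, hv, hw⟩, fun ⟨v, w, h, hv, hw⟩ => ⟨v, hv, w, hw, h⟩⟩

theorem regLE_supportIn_transversals {K : Type u} [CommRing K] {ρ : ℤ} (hρ : 2 ≤ ρ)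
    (h : RegLE K ρ G.edgeExponents) {l : Multiset (V × V)} (hl : ∀ p ∈ l, G.Adj p.1 p.2) :
    RegLE K ρ (supportIn (G.transversals l)) := by
  classical
  -- Quadratic generation is carried through the induction, since each intersection of colons
  -- requires it.
  suffices RegLE K ρ (supportIn (G.transversals l)) ∧ QuadraticallyGenerated (G.transversals l) from
    this.1
  induction l using Multiset.induction_on with
  | empty =>
    refine ⟨by rwa [supportIn_transversals_zero], fun A hA => ?_⟩
    obtain ⟨v, hv, w, hw, hvw⟩ := mem_transversals_zero_iff.1 hA
    exact ⟨{v, w}, pair_mem_transversals hvw 0, by simp [Finset.insert_subset_iff, hv, hw],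
      Finset.card_le_two⟩
  | cons p l ih =>
    obtain ⟨h₁, h₂⟩ := ih fun q hq => hl q (Multiset.mem_cons_of_mem hq)
    rw [transversals_cons]
    have hup := isUpperSet_transversals (G := G) l
    exact ⟨RegLE.inter_colon hρ hup h₂
      (pair_mem_transversals (hl p (Multiset.mem_cons_self p l)) l) h₁, h₂.inter_colon hup _ _⟩

theorem finite_edgeProducts (s : ℕ) : (G.edgeProducts s).Finite := by
  refine (Finsupp.finite_of_degree_eq (σ := V) (2 * s)).subset ?_
  rintro _ ⟨l, rfl, -, rfl⟩
  exact degree_edgeSum l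

/-- Downward induction along the lexicographic chain: at each stage the colon has bound ρ, and
shifting it by a product of s edges gives ρ + 2s ≤ r. -/
theorem regLE_symbolicExponents {K : Type u} [CommRing K] {ρ r : ℤ} {s : ℕ} (hρ : 2 ≤ ρ)
    (hr : ρ + 2 * s ≤ r) (h₁ : RegLE K ρ G.edgeExponents)
    (h₂ : RegLE K r (G.symbolicExponents (s + 1) ∪ G.powerExponents s)) :
    RegLE K r (G.symbolicExponents (s + 1)) := by
  classical
  cases nonempty_fintype V
  let _ : LinearOrder V := LinearOrder.lift' (Fintype.equivFin V) (Equiv.injective _)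
  let U : Finset (Lex (V →₀ ℕ)) → Set (V →₀ ℕ) := fun S =>
    G.symbolicExponents (s + 1) ∪ {a | ∃ m ∈ ofLex '' (S : Set (Lex (V →₀ ℕ))), m ≤ a}
  let T : Finset (Lex (V →₀ ℕ)) := (finite_edgeProducts (G := G) s).toFinset.map toLex.toEmbedding
  have hT : ∀ x, x ∈ T ↔ ofLex x ∈ G.edgeProducts s := by
    intro x
    simp only [T, Finset.mem_map_equiv, Set.Finite.mem_toFinset]
    rfl
  have hup : ∀ S : Set (V →₀ ℕ), IsUpperSet {a : V →₀ ℕ | ∃ m ∈ S, m ≤ a} :=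
    fun S _ _ h ⟨m, hm, hma⟩ => ⟨m, hm, hma.trans h⟩
  -- The remaining set S always contains every product larger than one of its members. Its smallest
  -- element is removed, so the colon is taken against exactly the larger products.
  have key : ∀ S : Finset (Lex (V →₀ ℕ)), (∀ x ∈ S, x ∈ T) →
      (∀ x ∈ S, ∀ y ∈ T, x < y → y ∈ S) → RegLE K r (U S) → RegLE K r (U ∅) := by
    intro S
    induction S using Finset.induction_on_min with
    | empty => exact fun _ _ h => h
    | insert x S hx ih =>
      intro hST hS h
      have hST' : ∀ y ∈ S, y ∈ T := fun y hy => hST y (Finset.mem_insert_of_mem hy)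
      have hS' : ∀ y ∈ T, x < y → y ∈ S := fun y hy hxy =>
        (Finset.mem_insert.1 (hS x (Finset.mem_insert_self _ _) y hy hxy)).resolve_left hxy.ne'
      refine ih hST' (fun y hy z hz hyz => hS' z hz ((hx y hy).trans hyz)) ?_
      obtain ⟨l, rfl, hl, hlx⟩ := (hT x).1 (hST x (Finset.mem_insert_self _ _))
      have hx' : x = toLex (edgeSum l) := by rw [hlx]; rfl
      have hdeg : (edgeSum l).degree = 2 * l.card := degree_edgeSum l
      have hUu : IsUpperSet (U S) := (isUpperSet_symbolicExponents _).union (hup _)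
      refine RegLE.left_of_union_of_inter hUu (isUpperSet_Ici (edgeSum l)) ?_ ?_
        (RegLE.Ici (by rw [hdeg]; push_cast; omega))
      · convert h using 1
        ext a
        simp only [U, Set.mem_union, Set.mem_ofPred_eq, Set.mem_Ici, Finset.coe_insert,
          Set.image_insert_eq, Set.mem_insert_iff, exists_eq_or_imp, hlx, or_assoc]
        rw [or_comm (a := ofLex x ≤ a)]
      · have hSmem : ∀ m, m ∈ ofLex '' (S : Set (Lex (V →₀ ℕ))) ↔
            m ∈ G.edgeProducts l.card ∧ toLex (edgeSum l) < toLex m := by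
          intro m
          rw [← hx']
          constructor
          · rintro ⟨y, hy, rfl⟩
            exact ⟨(hT y).1 (hST' y hy), hx y hy⟩
          · rintro ⟨hm, hlt⟩
            exact ⟨toLex m, hS' _ ((hT _).2 hm) hlt, rfl⟩
        let Z : Finset V := Finset.univ.filter fun z => Finsupp.single z 1 + edgeSum l ∈ U S
        have hcol := add_edgeSum_mem_union_iff hl hSmem (Z := Z) (fun z => by simp [Z, U])
        have hreg := (regLE_supportIn_transversals hρ h₁ hl).union_variables
          (isUpperSet_supportIn (isUpperSet_transversals l)) (by omega) Z
        refine RegLE.mono (r := ρ + (edgeSum l).degree) ?_ (by rw [hdeg]; push_cast; omega)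
        convert hreg.shift (edgeSum l) using 1
        ext a
        rw [Set.mem_ofPred_eq, ← hcol (a - edgeSum l), Set.mem_inter_iff, Set.mem_Ici, and_comm]
        refine and_congr_right fun ha => ?_
        rw [tsub_add_cancel_of_le ha]
  have h0 := key T (fun _ h => h) (fun _ _ _ h _ => h) (by
    convert h₂ using 1
    ext a
    simp only [U, Set.mem_union, powerExponents, Set.mem_ofPred_eq, Set.mem_image, Finset.mem_coe,
      hT]
    refine or_congr_right ⟨?_, ?_⟩
    · rintro ⟨_, ⟨y, hy, rfl⟩, hle⟩
      exact ⟨_, hy, hle⟩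
    · rintro ⟨m, hm, hle⟩
      exact ⟨m, ⟨toLex m, hm, rfl⟩, hle⟩)
  simpa [U] using h0

end SimpleGraph

end Covers

open MvPolynomial

/-! ### Homogeneous maps of graded free modules -/

section Graded

variable {K : Type u} {V : Type v} [Field K]

theorem mem_polyComponent {j : ℤ} {p : MvPolynomial V K} :
    p ∈ polyComponent K V j ↔ ∀ a, coeff a p ≠ 0 → (a.degree : ℤ) = j := by
  rw [polyComponent, mem_restrictSupport_iff]
  exact ⟨fun h a ha => h (mem_support_iff.2 ha), fun h a ha => h a (mem_support_iff.1 ha)⟩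

variable (K V) in
/-- The homomorphism system of the standard graded polynomial ring. -/
noncomputable def gradedSystem : HomSystem (MvPolynomial V K) ℤ where
  comp i j := (polyComponent K V (j - i)).toAddSubgroup
  one_mem j := by
    classical
    simp only [sub_self, Submodule.mem_toAddSubgroup, mem_polyComponent]
    intro a ha
    rw [coeff_one] at ha
    have : a = 0 := by
      by_contra h
      exact ha (if_neg (Ne.symm h))
    simp [this]
  mul_mem {i j k a b} ha hb := by
    classical
    simp only [Submodule.mem_toAddSubgroup, mem_polyComponent] at ha hb ⊢
    intro c hc
    rw [coeff_mul] at hc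
    obtain ⟨x, hx, hne⟩ := Finset.exists_ne_zero_of_sum_ne_zero hc
    have h₁ := ha _ (left_ne_zero_of_mul hne)
    have h₂ := hb _ (right_ne_zero_of_mul hne)
    rw [← Finset.HasAntidiagonal.mem_antidiagonal.1 hx, map_add]
    push_cast
    omega

theorem mem_gradedSystem_free {ι : Type*} {e : ι → ℤ} {j : ℤ} {x : ι → MvPolynomial V K} :
    x ∈ (gradedSystem K V).free e j ↔ ∀ i a, coeff a (x i) ≠ 0 → (a.degree : ℤ) + e i = j := by
  rw [mem_free]
  refine forall_congr' fun i => ?_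
  change x i ∈ polyComponent K V (j - e i) ↔ _
  rw [mem_polyComponent]
  refine forall_congr' fun a => imp_congr_right fun _ => ?_
  omega

theorem mem_freeComponent_iff {m : ℕ} {e : Fin m → ℤ} {j : ℤ} {x : Fin m → MvPolynomial V K} :
    x ∈ freeComponent K V e j ↔ x ∈ (gradedSystem K V).free e j := by
  rw [mem_free]
  rfl

/-- The projection of a graded free module to its component of degree `j`. -/
noncomputable def freeProj {ι : Type*} (e : ι → ℤ) (j : ℤ) :
    (ι → MvPolynomial V K) →ₗ[K] (ι → MvPolynomial V K) :=
  LinearMap.pi fun i =>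
    (if 0 ≤ j - e i then homogeneousComponent (j - e i).toNat else 0) ∘ₗ LinearMap.proj i

theorem coeff_freeProj {ι : Type*} (e : ι → ℤ) (j : ℤ) (x : ι → MvPolynomial V K) (i : ι)
    (a : V →₀ ℕ) :
    coeff a (freeProj e j x i) = if (a.degree : ℤ) + e i = j then coeff a (x i) else 0 := by
  simp only [freeProj, LinearMap.pi_apply, LinearMap.comp_apply, LinearMap.proj_apply]
  split_ifs with h₁ h₂ h₂
  · rw [coeff_homogeneousComponent, if_pos (by omega)]
  · rw [coeff_homogeneousComponent, if_neg (by omega)]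
  · omega
  · simp

theorem freeProj_mem {ι : Type*} (e : ι → ℤ) (j : ℤ) (x : ι → MvPolynomial V K) :
    freeProj e j x ∈ (gradedSystem K V).free e j := by
  rw [mem_gradedSystem_free]
  intro i a ha
  rw [coeff_freeProj] at ha
  by_contra h
  exact ha (if_neg h)

theorem freeProj_eq_self {ι : Type*} {e : ι → ℤ} {j : ℤ} {x : ι → MvPolynomial V K}
    (hx : x ∈ (gradedSystem K V).free e j) : freeProj e j x = x := by
  rw [mem_gradedSystem_free] at hx
  funext i
  ext a
  rw [coeff_freeProj]
  split_ifs with h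
  · rfl
  · by_contra hne
    exact h (hx i a (Ne.symm hne))

theorem freeProj_eq_zero {ι : Type*} {e : ι → ℤ} {j k : ℤ} (hjk : j ≠ k)
    {x : ι → MvPolynomial V K} (hx : x ∈ (gradedSystem K V).free e k) : freeProj e j x = 0 := by
  rw [mem_gradedSystem_free] at hx
  funext i
  ext a
  rw [coeff_freeProj]
  split_ifs with h
  · by_contra hne
    exact hjk (h.symm.trans (hx i a hne))
  · simp

/-- Homogeneous maps between graded free modules commute with the projections to components. -/
theorem map_freeProj {ι κ : Type*} [Finite ι] {e : ι → ℤ} {e' : κ → ℤ}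
    {f : (ι → MvPolynomial V K) →ₗ[MvPolynomial V K] (κ → MvPolynomial V K)}
    (hf : ∀ j, ∀ x ∈ (gradedSystem K V).free e j, f x ∈ (gradedSystem K V).free e' j) (j : ℤ)
    (x : ι → MvPolynomial V K) : f (freeProj e j x) = freeProj e' j (f x) := by
  classical
  suffices h : f.restrictScalars K ∘ₗ freeProj e j = freeProj e' j ∘ₗ f.restrictScalars K from
    LinearMap.congr_fun h x
  refine LinearMap.pi_ext' fun i => (basisMonomials V K).ext fun d => ?_
  rw [coe_basisMonomials]
  change f (freeProj e j (Pi.single i (monomial d 1))) =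
    freeProj e' j (f (Pi.single i (monomial d 1)))
  have hmem : Pi.single i (monomial d (1 : K)) ∈ (gradedSystem K V).free e (d.degree + e i) := by
    rw [mem_gradedSystem_free]
    intro k a ha
    by_cases hk : k = i
    · subst hk
      rw [Pi.single_eq_same, coeff_monomial] at ha
      have : d = a := by
        by_contra h
        exact ha (if_neg h)
      rw [this]
    · simp [Pi.single_eq_of_ne hk] at ha
  by_cases h : j = d.degree + e i
  · rw [h, freeProj_eq_self hmem, freeProj_eq_self (hf _ _ hmem)]
  · rw [freeProj_eq_zero h hmem, freeProj_eq_zero h (hf _ _ hmem), map_zero]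

/-- A homogeneous element in the image of a homogeneous map has a homogeneous preimage. -/
theorem exists_homogeneous_preimage {ι κ : Type*} [Finite ι] {e : ι → ℤ} {e' : κ → ℤ}
    {f : (ι → MvPolynomial V K) →ₗ[MvPolynomial V K] (κ → MvPolynomial V K)}
    (hf : ∀ j, ∀ x ∈ (gradedSystem K V).free e j, f x ∈ (gradedSystem K V).free e' j) {j : ℤ}
    {x : ι → MvPolynomial V K} (hx : f x ∈ (gradedSystem K V).free e' j) :
    ∃ y ∈ (gradedSystem K V).free e j, f y = f x :=
  ⟨freeProj e j x, freeProj_mem e j x, by rw [map_freeProj hf, freeProj_eq_self hx]⟩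

theorem monotone_Iic_int : Monotone (Set.Iic : ℤ → Set ℤ) := fun _ _ h => Set.Iic_subset_Iic.2 h

/-- A minimal homogeneous cover of a module with bounded resolutions has generators of bounded
degree, and its kernel has bounded resolutions. -/
theorem HomSystem.Resolved.of_minimal_cover {E : Type (max u v)} [AddCommGroup E]
    [Module (MvPolynomial V K) E] {N : ℤ → AddSubgroup E} {r : ℤ}
    (hN : ∀ n, (gradedSystem K V).Resolved Set.Iic n r N) {ι : Type} [Fintype ι] {e : ι → ℤ}
    {f : (ι → MvPolynomial V K) →ₗ[MvPolynomial V K] E}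
    (hf : mapFamily ((gradedSystem K V).free e) f = N)
    (hmin : ∀ x, f x = 0 → ∀ i, constantCoeff (x i) = 0) :
    (∀ i, e i ≤ r) ∧ ∀ n, (gradedSystem K V).Resolved Set.Iic n (r + 1)
      (kerFamily ((gradedSystem K V).free e) f) := by
  classical
  have he : ∀ i, e i ≤ r := by
    intro i
    -- Lift a cover by generators of degree at most r through `f`. By minimality the lift of the
    -- image of basis vector i has constant term 1 in coordinate i; but in degree e i > r the
    -- coefficients over those generators have no constant terms.
    by_contra! hi
    obtain ⟨κ, _, b, g, hb, hg, -⟩ := hN 1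
    obtain ⟨l, hl, -⟩ := exists_lift (𝒜 := gradedSystem K V) (stable_free e) (p := f) (f := g)
      (b := b) (fun j c hc => by
        rw [hf, ← hg]
        exact ⟨c, hc, rfl⟩)
    obtain ⟨c, hc, hce⟩ : f (Pi.single i 1) ∈ mapFamily ((gradedSystem K V).free b) g (e i) := by
      rw [hg, ← hf]
      exact ⟨_, single_mem_free e i, rfl⟩
    replace hce : g c = f (Pi.single i 1) := hce
    have h0 := hmin (Pi.single i 1 - l c) (by
      rw [map_sub, ← hce, ← hl]
      exact sub_self _) i
    rw [Pi.sub_apply, Pi.single_eq_same, map_sub, map_one, sub_eq_zero] at h0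
    have hlc : constantCoeff (l c i) = 0 := by
      rw [LinearMap.pi_apply_eq_sum_univ l c, Finset.sum_apply, map_sum]
      refine Finset.sum_eq_zero fun k _ => ?_
      have hck : constantCoeff (c k) = 0 := by
        by_contra hne
        have h1 := mem_gradedSystem_free.1 hc k 0 hne
        have h2 : b k ≤ r := hb k
        rw [map_zero] at h1
        push_cast at h1
        omega
      rw [Pi.smul_apply, smul_eq_mul, map_mul, hck, zero_mul]
    exact one_ne_zero (h0.trans hlc)
  refine ⟨he, fun n => ?_⟩
  refine Resolved.kernel monotone_Iic_int (stable_free e) f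
    (resolved_free (fun i => (he i).trans (by omega : r ≤ r + 1)) n) ?_
  rw [hf, add_sub_cancel_right]
  exact hN (n + 1)

end Graded

/-! ### From multigraded to standard graded resolutions -/

section Realize

variable {K : Type u} {V : Type v} [Field K] {ι κ : Type*}

/-- The vector of the coefficients of the monomial with exponent `a`. -/
noncomputable def coeffVec (a : V →₀ ℕ) (x : ι → MvPolynomial V K) : ι → K := fun i => coeff a (x i)

theorem exists_coeffVec_eq (s : Finset (V →₀ ℕ)) (c : (V →₀ ℕ) → ι → K) (hc : ∀ a ∉ s, c a = 0) :
    ∃ x : ι → MvPolynomial V K, ∀ a, coeffVec a x = c a := by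
  classical
  refine ⟨fun i => ∑ a ∈ s, monomial a (c a i), fun a => ?_⟩
  funext i
  simp only [coeffVec, coeff_sum, coeff_monomial, Finset.sum_ite_eq']
  split_ifs with h
  · rfl
  · rw [hc a h]
    rfl

theorem exists_support_coeffVec [Finite ι] (x : ι → MvPolynomial V K) :
    ∃ s : Finset (V →₀ ℕ), ∀ a ∉ s, coeffVec a x = 0 := by
  classical
  cases nonempty_fintype ι
  refine ⟨Finset.univ.biUnion fun i => (x i).support, fun a ha => ?_⟩
  funext i
  by_contra h
  exact ha (Finset.mem_biUnion.2 ⟨i, Finset.mem_univ i, mem_support_iff.2 h⟩)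

theorem coeffVec_injective {x y : ι → MvPolynomial V K} (h : ∀ a, coeffVec a x = coeffVec a y) :
    x = y := by
  funext i
  ext a
  exact congrFun (h a) i

/-- Multiplication of the `i`-th coordinate by the monomial with exponent `b i`. -/
noncomputable def mulMonomials (K : Type*) [Field K] (b : ι → V →₀ ℕ) :
    (ι → MvPolynomial V K) →ₗ[MvPolynomial V K] (ι → MvPolynomial V K) :=
  LinearMap.pi fun i => monomial (b i) (1 : K) • LinearMap.proj i

theorem coeffVec_mulMonomials_add (b : ι → V →₀ ℕ) (x : ι → MvPolynomial V K) (i : ι)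
    (a : V →₀ ℕ) : coeffVec (b i + a) (mulMonomials K b x) i = coeff a (x i) := by
  simp [coeffVec, mulMonomials, coeff_monomial_mul]

theorem coeffVec_mulMonomials_mem (b : ι → V →₀ ℕ) (x : ι → MvPolynomial V K) (a : V →₀ ℕ) :
    coeffVec a (mulMonomials K b x) ∈ (ofPreorder K (V →₀ ℕ)).free b a := by
  classical
  rw [mem_free_ofPreorder]
  intro i hi
  by_contra h
  refine hi ?_
  simp [coeffVec, mulMonomials, coeff_monomial_mul', h]

theorem mulMonomials_injective (b : ι → V →₀ ℕ) : Function.Injective (mulMonomials K b) := by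
  intro x y h
  funext i
  ext a
  rw [← coeffVec_mulMonomials_add b x, h, coeffVec_mulMonomials_add]

theorem exists_mulMonomials_eq {b : ι → V →₀ ℕ} {x : ι → MvPolynomial V K}
    (hx : ∀ a, coeffVec a x ∈ (ofPreorder K (V →₀ ℕ)).free b a) : ∃ y, mulMonomials K b y = x := by
  classical
  refine ⟨fun i => divMonomial (x i) (b i), ?_⟩
  funext i
  ext a
  simp only [mulMonomials, LinearMap.pi_apply, LinearMap.smul_apply, LinearMap.proj_apply,
    smul_eq_mul, coeff_monomial_mul', one_mul, coeff_divMonomial]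
  split_ifs with h
  · rw [add_tsub_cancel_of_le h]
  · by_contra hne
    exact h (mem_free_ofPreorder.1 (hx a) i (Ne.symm hne))

variable [Fintype ι]

open Classical in
/-- The extension of scalars of a linear map from `K` to the polynomial ring. -/
noncomputable def extendScalars (V : Type*) (f : (ι → K) →ₗ[K] (κ → K)) :
    (ι → MvPolynomial V K) →ₗ[MvPolynomial V K] (κ → MvPolynomial V K) :=
  Fintype.linearCombination (MvPolynomial V K) fun i k => C (f (Pi.single i 1) k)

theorem coeffVec_extendScalars (f : (ι → K) →ₗ[K] (κ → K)) (x : ι → MvPolynomial V K)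
    (a : V →₀ ℕ) : coeffVec a (extendScalars V f x) = f (coeffVec a x) := by
  classical
  funext k
  rw [LinearMap.pi_apply_eq_sum_univ f]
  simp only [coeffVec, extendScalars, Fintype.linearCombination_apply, Finset.sum_apply,
    Pi.smul_apply, smul_eq_mul, coeff_sum]
  refine Finset.sum_congr rfl fun i _ => ?_
  rw [mul_comm (x i), coeff_C_mul, mul_comm]
  congr 1
  refine congrFun (congrArg f ?_) k
  funext j
  simp [Pi.single_apply, eq_comm]

theorem exists_extendScalars_eq [Finite κ] {N : (V →₀ ℕ) → AddSubgroup (ι → K)}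
    {f : (ι → K) →ₗ[K] (κ → K)} {x : κ → MvPolynomial V K}
    (hx : ∀ a, coeffVec a x ∈ mapFamily N f a) :
    ∃ y, (∀ a, coeffVec a y ∈ N a) ∧ extendScalars V f y = x ∧
      ∀ a, coeffVec a x = 0 → coeffVec a y = 0 := by
  classical
  choose c hc hfc using hx
  obtain ⟨s, hs⟩ := exists_support_coeffVec x
  -- Lifting zero components by zero leaves finitely many nonzero components and preserves
  -- homogeneity.
  obtain ⟨y, hy⟩ := exists_coeffVec_eq (V := V) s
    (fun a => if coeffVec a x = 0 then 0 else c a) (fun a ha => if_pos (hs a ha))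
  refine ⟨y, fun a => ?_, coeffVec_injective fun a => ?_, fun a ha => ?_⟩
  · rw [hy]
    split_ifs
    · exact zero_mem _
    · exact hc a
  · rw [coeffVec_extendScalars, hy]
    split_ifs with h
    · rw [h, map_zero]
    · exact hfc a
  · rw [hy, if_pos ha]

/-- The components for the standard grading of the module with the multigraded components `N`. -/
def realize (N : (V →₀ ℕ) → AddSubgroup (κ → K)) (j : ℤ) : AddSubgroup (κ → MvPolynomial V K) where
  carrier := {x | ∀ a, coeffVec a x ∈ N a ∧ (coeffVec a x ≠ 0 → (a.degree : ℤ) = j)}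
  zero_mem' a := by
    have : coeffVec a (0 : κ → MvPolynomial V K) = 0 := by
      funext i
      simp [coeffVec]
    simp [this, zero_mem]
  add_mem' {x y} hx hy a := by
    have : coeffVec a (x + y) = coeffVec a x + coeffVec a y := by
      funext i
      simp [coeffVec]
    rw [this]
    refine ⟨add_mem (hx a).1 (hy a).1, fun h => ?_⟩
    by_cases h0 : coeffVec a x = 0
    · rw [h0, zero_add] at h
      exact (hy a).2 h
    · exact (hx a).2 h0
  neg_mem' {x} hx a := by
    have : coeffVec a (-x) = -coeffVec a x := by
      funext i
      simp [coeffVec]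
    rw [this]
    exact ⟨neg_mem (hx a).1, fun h => (hx a).2 (neg_ne_zero.1 h)⟩

theorem mem_realize {N : (V →₀ ℕ) → AddSubgroup (κ → K)} {j : ℤ} {x : κ → MvPolynomial V K} :
    x ∈ realize N j ↔ ∀ a, coeffVec a x ∈ N a ∧ (coeffVec a x ≠ 0 → (a.degree : ℤ) = j) := Iff.rfl

theorem mulMonomials_mem_realize_free {ι : Type*} {b : ι → V →₀ ℕ} {j : ℤ} {x : ι → MvPolynomial V K} :
    mulMonomials K b x ∈ realize ((ofPreorder K (V →₀ ℕ)).free b) j ↔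
      x ∈ (gradedSystem K V).free (fun i => ((b i).degree : ℤ)) j := by
  rw [mem_realize, mem_gradedSystem_free]
  constructor
  · intro h i a ha
    rw [← coeffVec_mulMonomials_add b] at ha
    have := (h (b i + a)).2 (fun h0 => ha (by rw [h0]; rfl))
    rw [map_add] at this
    push_cast at this
    omega
  · refine fun h a => ⟨coeffVec_mulMonomials_mem b x a, fun hne => ?_⟩
    obtain ⟨i, hi⟩ := Function.ne_iff.1 hne
    have hba := mem_free_ofPreorder.1 (coeffVec_mulMonomials_mem b x a) i hi
    obtain ⟨d, rfl⟩ := exists_add_of_le hba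
    have := h i d (by
      rw [← coeffVec_mulMonomials_add b]
      exact hi)
    rw [map_add]
    push_cast
    omega

theorem mapFamily_mulMonomials {ι : Type*} (b : ι → V →₀ ℕ) :
    mapFamily ((gradedSystem K V).free fun i => ((b i).degree : ℤ)) (mulMonomials K b) =
      realize ((ofPreorder K (V →₀ ℕ)).free b) := by
  rw [mapFamily_eq_iff]
  refine ⟨fun j x hx => mulMonomials_mem_realize_free.2 hx, fun j y hy => ?_⟩
  obtain ⟨x, rfl⟩ := exists_mulMonomials_eq fun a => (hy a).1
  exact ⟨x, mulMonomials_mem_realize_free.1 hy, rfl⟩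

theorem mapFamily_extendScalars [Finite κ] (N : (V →₀ ℕ) → AddSubgroup (ι → K))
    (f : (ι → K) →ₗ[K] (κ → K)) :
    mapFamily (realize N) (extendScalars V f) = realize (mapFamily N f) := by
  rw [mapFamily_eq_iff]
  refine ⟨fun j x hx a => ?_, fun j x hx => ?_⟩
  · rw [coeffVec_extendScalars]
    refine ⟨⟨_, (hx a).1, rfl⟩, fun h => (hx a).2 fun h0 => h ?_⟩
    rw [h0, map_zero]
  · obtain ⟨y, hy, rfl, h0⟩ := exists_extendScalars_eq fun a => (hx a).1
    exact ⟨y, fun a => ⟨hy a, fun h => (hx a).2 fun h' => h (h0 a h')⟩, rfl⟩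

theorem kerFamily_extendScalars (N : (V →₀ ℕ) → AddSubgroup (ι → K))
    (f : (ι → K) →ₗ[K] (κ → K)) :
    kerFamily (realize N) (extendScalars V f) = realize (kerFamily N f) := by
  funext j
  ext x
  rw [mem_kerFamily, mem_realize, mem_realize]
  constructor
  · rintro ⟨h₁, h₂⟩ a
    refine ⟨⟨(h₁ a).1, ?_⟩, (h₁ a).2⟩
    change f (coeffVec a x) = 0
    rw [← coeffVec_extendScalars, h₂]
    funext k
    simp [coeffVec]
  · refine fun h => ⟨fun a => ⟨(h a).1.1, (h a).2⟩, coeffVec_injective fun a => ?_⟩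
    rw [coeffVec_extendScalars]
    refine (show f (coeffVec a x) = 0 from (h a).1.2).trans ?_
    funext k
    simp [coeffVec]

theorem HomSystem.Resolved.of_mapFamily {R : Type u} {Γ : Type*} [CommRing R]
    {𝒜 : HomSystem R Γ} {B : ℤ → Set Γ} {E E' : Type u} [AddCommGroup E] [Module R E]
    [AddCommGroup E'] [Module R E'] {n : ℕ} {r : ℤ} {N : Γ → AddSubgroup E} (hN : 𝒜.Stable N)
    {f : E →ₗ[R] E'} (hf : ∀ j, ∀ x ∈ N j, f x = 0 → x = 0)
    (h : 𝒜.Resolved B n r (mapFamily N f)) : 𝒜.Resolved B n r N := by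
  refine Resolved.extension hN f ?_ h
  convert resolved_bot (E := E) n r using 1
  funext j
  ext x
  rw [mem_kerFamily, AddSubgroup.mem_bot]
  exact ⟨fun hx => hf j x hx.1 hx.2, fun hx => hx ▸ ⟨zero_mem _, map_zero f⟩⟩

/-- Multigraded resolutions give graded resolutions over the polynomial ring. -/
theorem HomSystem.Resolved.realize {κ : Type} [Finite κ] {n : ℕ} {r : ℤ}
    {N : (V →₀ ℕ) → AddSubgroup (κ → K)}
    (h : (ofPreorder K (V →₀ ℕ)).Resolved (degreeLE V) n r N) :
    (gradedSystem K V).Resolved Set.Iic n r (_root_.realize N) := by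
  induction n generalizing r κ with
  | zero => trivial
  | succ n ih =>
    obtain ⟨ι, _, b, f, hb, rfl, hK⟩ := h
    -- Basis vector i is realized as x^{b i} times a unit vector. This embedding is injective, so
    -- syzygies can be computed in its image.
    refine ⟨ι, inferInstance, fun i => (b i).degree, extendScalars V f ∘ₗ mulMonomials K b, hb, ?_,
      ?_⟩
    · rw [mapFamily_comp, mapFamily_mulMonomials, mapFamily_extendScalars]
    · refine Resolved.of_mapFamily ((stable_free _).ker _) (f := mulMonomials K b)
        (fun j x _ h0 => mulMonomials_injective b (h0.trans (map_zero _).symm)) ?_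
      convert ih hK using 1
      rw [← kerFamily_extendScalars, ← mapFamily_mulMonomials, mapFamily_eq_iff]
      refine ⟨fun j x hx => ⟨⟨x, hx.1, rfl⟩, hx.2⟩, ?_⟩
      rintro j _ ⟨⟨x, hx, rfl⟩, h0⟩
      exact ⟨x, ⟨hx, h0⟩, rfl⟩

end Realize

/-! ### Monomial ideals as graded modules and bounds on their shifts -/

section MonomialIdeal

variable (K : Type u) {V : Type v} [Field K]

/-- The monomial ideal with exponent set `U`, as a multigraded family on `K ^ 1`. -/
noncomputable def vectorFamily (U : Set (V →₀ ℕ)) : (V →₀ ℕ) → AddSubgroup (Fin 1 → K) :=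
  mapFamily (monomialFamily K U) (LinearMap.pi fun _ => LinearMap.id : K →ₗ[K] (Fin 1 → K))

variable {K} {U : Set (V →₀ ℕ)} {hU : IsUpperSet U}

theorem mem_vectorFamily {a : V →₀ ℕ} {c : Fin 1 → K} :
    c ∈ vectorFamily K U a ↔ (c 0 ≠ 0 → a ∈ U) := by
  constructor
  · rintro ⟨x, hx, rfl⟩
    exact mem_monomialFamily.1 hx
  · intro h
    refine ⟨c 0, mem_monomialFamily.2 h, ?_⟩
    funext i
    rw [Subsingleton.elim i 0]
    rfl

theorem resolved_vectorFamily_iff (hU : IsUpperSet U) {n : ℕ} {r : ℤ} :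
    (ofPreorder K (V →₀ ℕ)).Resolved (degreeLE V) n r (vectorFamily K U) ↔
      (ofPreorder K (V →₀ ℕ)).Resolved (degreeLE V) n r (monomialFamily K U) := by
  have hinj : ∀ a, ∀ x ∈ monomialFamily K U a,
      (LinearMap.pi fun _ => LinearMap.id : K →ₗ[K] (Fin 1 → K)) x = 0 → x = 0 :=
    fun a x _ h0 => congrFun h0 0
  exact ⟨fun h => h.of_mapFamily (stable_monomialFamily hU) hinj, fun h => h.map_of_injOn hinj⟩

theorem mem_restrictSupportIdeal {p : MvPolynomial V K} :
    p ∈ restrictSupportIdeal (R := K) U hU ↔ ∀ a, coeff a p ≠ 0 → a ∈ U := by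
  change p ∈ restrictSupport K U ↔ _
  rw [mem_restrictSupport_iff]
  exact ⟨fun h a ha => h (mem_support_iff.2 ha), fun h a ha => h a (mem_support_iff.1 ha)⟩

/-- The inclusion of an ideal of the polynomial ring in a free module of rank one. -/
noncomputable def idealToFree (I : Ideal (MvPolynomial V K)) :
    I →ₗ[MvPolynomial V K] (Fin 1 → MvPolynomial V K) :=
  LinearMap.pi fun _ => I.subtype

theorem idealToFree_injective (I : Ideal (MvPolynomial V K)) :
    Function.Injective (idealToFree I) :=
  fun _ _ h => Subtype.ext (congrFun h 0)

theorem idealToFree_mem_free_iff {I : Ideal (MvPolynomial V K)} {j : ℤ} {x : I} :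
    idealToFree I x ∈ (gradedSystem K V).free (fun _ => 0) j ↔ x ∈ idealComponent I j := by
  rw [mem_gradedSystem_free]
  change _ ↔ (x : MvPolynomial V K) ∈ polyComponent K V j
  rw [mem_polyComponent]
  simp only [add_zero]
  exact ⟨fun h => h 0, fun h _ => h⟩

theorem mapFamily_idealToFree :
    mapFamily (fun j => (idealComponent (restrictSupportIdeal (R := K) U hU) j).toAddSubgroup)
      (idealToFree _) = realize (vectorFamily K U) := by
  have key : ∀ (j : ℤ) (x : Fin 1 → MvPolynomial V K), x ∈ realize (vectorFamily K U) j ↔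
      x 0 ∈ restrictSupportIdeal (R := K) U hU ∧ x 0 ∈ polyComponent K V j := by
    intro j x
    rw [mem_realize, mem_restrictSupportIdeal, mem_polyComponent, ← forall_and]
    refine forall_congr' fun a => ?_
    rw [mem_vectorFamily, Function.ne_iff]
    refine and_congr Iff.rfl (imp_congr_left ?_)
    simp [coeffVec]
  rw [mapFamily_eq_iff]
  refine ⟨fun j x hx => (key _ _).2 ⟨x.2, hx⟩, fun j x hx => ?_⟩
  rw [key] at hx
  refine ⟨⟨x 0, hx.1⟩, hx.2, ?_⟩
  funext i
  rw [Subsingleton.elim i 0]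
  rfl

theorem stable_idealComponent (I : Ideal (MvPolynomial V K)) :
    (gradedSystem K V).Stable fun j => (idealComponent I j).toAddSubgroup := by
  intro i j a x ha hx
  rw [Submodule.mem_toAddSubgroup, ← idealToFree_mem_free_iff] at hx ⊢
  rw [map_smul]
  exact stable_free _ ha hx

theorem RegLE.resolved_idealComponent {r : ℤ} (h : RegLE K r U) (n : ℕ) :
    (gradedSystem K V).Resolved Set.Iic n r
      fun j => (idealComponent (restrictSupportIdeal (R := K) U hU) j).toAddSubgroup := by
  refine Resolved.of_mapFamily (stable_idealComponent _) (f := idealToFree _)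
    (fun j x _ h0 => idealToFree_injective _ (h0.trans (map_zero _).symm)) ?_
  rw [mapFamily_idealToFree]
  exact ((resolved_vectorFamily_iff hU).2 (h n)).realize

/-- Multigraded resolutions bound the degrees in any minimal graded free resolution. -/
theorem RegLE.shift_le {r : ℤ} (h : RegLE K r U)
    (F : MinimalGradedFreeResolution K V (restrictSupportIdeal (R := K) U hU)
      (idealComponent _)) (i : ℕ) (a : Fin (F.rank i)) : F.shift i a ≤ r + i := by
  let I := restrictSupportIdeal (R := K) U hU
  let 𝒢 := gradedSystem K V
  have hd : ∀ i j, ∀ x ∈ 𝒢.free (F.shift (i + 1)) j, F.d i x ∈ 𝒢.free (F.shift i) j := by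
    intro i j x hx
    rw [← mem_freeComponent_iff] at hx ⊢
    exact F.d_mem i j x hx
  have haug : ∀ j, ∀ x ∈ 𝒢.free (F.shift 0) j,
      (idealToFree I ∘ₗ F.aug) x ∈ 𝒢.free (fun _ => 0) j := by
    intro j x hx
    rw [← mem_freeComponent_iff] at hx
    exact idealToFree_mem_free_iff.2 (F.aug_mem j x hx)
  have hcov : mapFamily (𝒢.free (F.shift 0)) F.aug =
      fun j => (idealComponent I j).toAddSubgroup := by
    rw [mapFamily_eq_iff]
    refine ⟨fun j x hx => F.aug_mem j x (mem_freeComponent_iff.2 hx), fun j y hy => ?_⟩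
    obtain ⟨x, rfl⟩ := F.aug_surjective y
    obtain ⟨x', hx', heq⟩ := exists_homogeneous_preimage haug
      (x := x) (j := j) (idealToFree_mem_free_iff.2 hy)
    exact ⟨x', hx', idealToFree_injective I heq⟩
  have hker : ∀ (E : Type (max u v)) [AddCommGroup E] [Module (MvPolynomial V K) E] (i : ℕ)
      (f : (Fin (F.rank i) → MvPolynomial V K) →ₗ[MvPolynomial V K] E),
      Function.Exact (F.d i) f →
      mapFamily (𝒢.free (F.shift (i + 1))) (F.d i) = kerFamily (𝒢.free (F.shift i)) f := by
    intro E _ _ i f hex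
    rw [mapFamily_eq_iff]
    refine ⟨fun j x hx => ⟨hd i j x hx, (hex _).2 ⟨x, rfl⟩⟩, fun j y hy => ?_⟩
    obtain ⟨x, rfl⟩ := (hex y).1 hy.2
    exact exists_homogeneous_preimage (hd i) hy.1
  have hmin : ∀ (E : Type (max u v)) [AddCommGroup E] [Module (MvPolynomial V K) E] (i : ℕ)
      (f : (Fin (F.rank i) → MvPolynomial V K) →ₗ[MvPolynomial V K] E),
      Function.Exact (F.d i) f → ∀ x, f x = 0 → ∀ a, constantCoeff (x a) = 0 := by
    intro E _ _ i f hex x hx a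
    obtain ⟨y, rfl⟩ := (hex x).1 hx
    exact F.minimal i y a
  -- Walk up the minimal resolution: each syzygy module inherits bounded resolutions, with the bound
  -- raised by one.
  have key : ∀ i : ℕ, (∀ a, F.shift i a ≤ r + i) ∧
      ∀ n, 𝒢.Resolved Set.Iic n (r + (i + 1 : ℕ))
        (mapFamily (𝒢.free (F.shift (i + 1))) (F.d i)) := by
    intro i
    induction i with
    | zero =>
      have := Resolved.of_minimal_cover (fun n => h.resolved_idealComponent n) hcov
        (hmin _ 0 _ F.exact_zero)
      rw [hker _ 0 _ F.exact_zero]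
      simpa using this
    | succ i ih =>
      have := Resolved.of_minimal_cover ih.2 rfl (hmin _ (i + 1) _ (F.exact_succ i))
      rw [hker _ (i + 1) _ (F.exact_succ i)]
      refine ⟨this.1, fun n => ?_⟩
      have h2 := this.2 n
      rwa [add_assoc] at h2
  exact (key i).1 a

end MonomialIdeal

/-! ### Existence of minimal multigraded resolutions -/

section Existence

variable {K : Type u} {V : Type v} [Field K]

theorem coeffVec_smul [DecidableEq V] {κ : Type*} (p : MvPolynomial V K)
    (x : κ → MvPolynomial V K) (a : V →₀ ℕ) : coeffVec a (p • x) =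
      ∑ d ∈ Finset.HasAntidiagonal.antidiagonal a, coeff d.1 p • coeffVec d.2 x := by
  funext i
  simp [coeffVec, coeff_mul]

/-- The module with the multigraded components `N`. -/
def realizeSubmodule {κ : Type*} (N : (V →₀ ℕ) → AddSubgroup (κ → K))
    (hN : (ofPreorder K (V →₀ ℕ)).Stable N) :
    Submodule (MvPolynomial V K) (κ → MvPolynomial V K) where
  carrier := {x | ∀ a, coeffVec a x ∈ N a}
  zero_mem' a := by
    have : coeffVec a (0 : κ → MvPolynomial V K) = 0 := by
      funext i
      simp [coeffVec]
    rw [this]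
    exact zero_mem _
  add_mem' {x y} hx hy a := by
    have : coeffVec a (x + y) = coeffVec a x + coeffVec a y := by
      funext i
      simp [coeffVec]
    rw [this]
    exact add_mem (hx a) (hy a)
  smul_mem' p x hx a := by
    classical
    rw [stable_ofPreorder_iff] at hN
    rw [coeffVec_smul]
    refine sum_mem fun d hd => hN.1 ?_ (hN.2 d.2 _ _ (hx d.2))
    rw [← Finset.HasAntidiagonal.mem_antidiagonal.1 hd]
    exact le_add_self

/-- The realized submodule of a free module is finitely generated because the polynomial ring is
Noetherian, and the multigraded components of its generators generate the family. -/
theorem exists_finite_cover [Finite V] {m : ℕ} {N : (V →₀ ℕ) → AddSubgroup (Fin m → K)}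
    (hN : (ofPreorder K (V →₀ ℕ)).Stable N) :
    ∃ (k : ℕ) (b : Fin k → V →₀ ℕ) (f : (Fin k → K) →ₗ[K] (Fin m → K)),
      mapFamily ((ofPreorder K (V →₀ ℕ)).free b) f = N := by
  classical
  obtain ⟨t, ht⟩ := IsNoetherian.noetherian (realizeSubmodule N hN)
  choose s hs using fun x : Fin m → MvPolynomial V K => exists_support_coeffVec x
  let P : Finset ((V →₀ ℕ) × (Fin m → K)) :=
    t.biUnion fun g => (s g).image fun a => (a, coeffVec a g)
  let b : Fin P.card → V →₀ ℕ := fun i => (P.equivFin.symm i).1.1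
  let y : Fin P.card → Fin m → K := fun i => (P.equivFin.symm i).1.2
  have hst : (ofPreorder K (V →₀ ℕ)).Stable
      (mapFamily ((ofPreorder K (V →₀ ℕ)).free b) (Fintype.linearCombination K y)) :=
    (stable_free b).map _
  refine ⟨P.card, b, Fintype.linearCombination K y, ?_⟩
  rw [mapFamily_eq_iff]
  refine ⟨fun a c hc => linearCombination_mem hN (fun i => ?_) hc, fun a v hv => ?_⟩
  · obtain ⟨g, hg, h⟩ := Finset.mem_biUnion.1 (P.equivFin.symm i).2
    obtain ⟨a, -, h⟩ := Finset.mem_image.1 h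
    have hmem : g ∈ realizeSubmodule N hN := ht ▸ Submodule.subset_span hg
    have h₁ : b i = a := congrArg Prod.fst h.symm
    have h₂ : y i = coeffVec a g := congrArg Prod.snd h.symm
    rw [h₁, h₂]
    exact hmem a
  · have hle : realizeSubmodule N hN ≤ realizeSubmodule _ hst := by
      rw [← ht, Submodule.span_le]
      intro g hg a
      by_cases ha : a ∈ s g
      · have hmem : (a, coeffVec a g) ∈ P :=
          Finset.mem_biUnion.2 ⟨g, hg, Finset.mem_image.2 ⟨a, ha, rfl⟩⟩
        have h := single_mem_free (𝒜 := ofPreorder K (V →₀ ℕ)) b (P.equivFin ⟨_, hmem⟩)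
        have hb : b (P.equivFin ⟨_, hmem⟩) = a := by simp [b]
        rw [hb] at h
        exact ⟨_, h, by
          change Fintype.linearCombination K y _ = _
          simp [Fintype.linearCombination_apply_single, y]⟩
      · rw [hs g a ha]
        exact zero_mem _
    obtain ⟨x, hx⟩ := exists_coeffVec_eq (V := V) {a} (fun d => if d = a then v else 0)
      (fun d hd => if_neg (by simpa using hd))
    have hxN : x ∈ realizeSubmodule N hN := by
      intro d
      rw [hx]
      split_ifs with h
      · exact h ▸ hv
      · exact zero_mem _
    have := hle hxN a
    rwa [hx, if_pos rfl] at this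

/-- Take a cover with the fewest generators. A syzygy in the degree of generator i with nonzero
entry there would express that generator through the others, making it redundant. -/
theorem exists_minimal_cover [Finite V] {m : ℕ} {N : (V →₀ ℕ) → AddSubgroup (Fin m → K)}
    (hN : (ofPreorder K (V →₀ ℕ)).Stable N) :
    ∃ (k : ℕ) (b : Fin k → V →₀ ℕ) (f : (Fin k → K) →ₗ[K] (Fin m → K)),
      mapFamily ((ofPreorder K (V →₀ ℕ)).free b) f = N ∧
      ∀ a, ∀ c ∈ kerFamily ((ofPreorder K (V →₀ ℕ)).free b) f a, ∀ i, b i = a → c i = 0 := by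
  classical
  have hex := exists_finite_cover hN
  obtain ⟨b, f, hf⟩ := Nat.find_spec hex
  refine ⟨Nat.find hex, b, f, hf, ?_⟩
  rintro _ c ⟨hc, hfc⟩ i rfl
  by_contra hne
  obtain ⟨k, hk⟩ : ∃ k, Nat.find hex = k + 1 := Nat.exists_eq_succ_of_ne_zero (by
    have := i.2
    omega)
  have hmin := fun k (hk : k < Nat.find hex) => Nat.find_min hex hk
  generalize Nat.find hex = q at *
  subst hk
  refine hmin k (Nat.lt_succ_self k) ⟨fun j => b (i.succAbove j),
    Fintype.linearCombination K fun j => f (Pi.single (i.succAbove j) 1), ?_⟩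
  have hsum : ∀ x : Fin (k + 1) → K, x i = 0 →
      Fintype.linearCombination K (fun j => f (Pi.single (i.succAbove j) 1))
        (fun j => x (i.succAbove j)) = f x := by
    intro x hx
    have h1 : f x = ∑ l, x l • f (Pi.single l 1) := by
      conv_lhs => rw [pi_eq_sum_univ' x, map_sum]
      refine Finset.sum_congr rfl fun l _ => ?_
      rw [map_smul]
    rw [h1, Fin.sum_univ_succAbove _ i, hx, zero_smul, zero_add, Fintype.linearCombination_apply]
  rw [mapFamily_eq_iff]
  refine ⟨fun a x hx => linearCombination_mem hN (fun j => ?_) hx, fun a y hy => ?_⟩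
  · rw [← hf]
    exact ⟨_, single_mem_free b _, rfl⟩
  · rw [← hf] at hy
    obtain ⟨x, hx, rfl⟩ := hy
    -- Subtracting a multiple of the syzygy clears coordinate i without changing the image; if x i ≠
    -- 0, the degree of x is at least that of c, so x' stays in the same component.
    let x' : Fin (k + 1) → K := x - (x i / c i) • c
    have hx' : x' ∈ (ofPreorder K (V →₀ ℕ)).free b a := by
      by_cases h : x i = 0
      · simpa [x', h] using hx
      · have hba := mem_free_ofPreorder.1 hx i h
        refine sub_mem hx (stable_free b (mem_ofPreorder_comp.2 fun _ => hba) hc)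
    have hxi : x' i = 0 := by
      simp [x', hne]
    have hfx : f x' = f x := by
      have : f c = 0 := hfc
      simp [x', this]
    refine ⟨fun j => x' (i.succAbove j), ?_, (hsum x' hxi).trans hfx⟩
    rw [mem_free_ofPreorder] at hx' ⊢
    exact fun j hj => hx' _ hj

variable (K V) in
/-- A multigraded submodule of a multigraded free module. -/
structure MultigradedSubmodule where
  rank : ℕ
  deg : Fin rank → V →₀ ℕ
  family : (V →₀ ℕ) → AddSubgroup (Fin rank → K)
  stable : (ofPreorder K (V →₀ ℕ)).Stable family
  le_free : ∀ a, family a ≤ (ofPreorder K (V →₀ ℕ)).free deg a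

namespace MultigradedSubmodule

variable [Finite V]

/-- The syzygies of a multigraded submodule with respect to a minimal cover. -/
theorem exists_syzygies (s : MultigradedSubmodule K V) :
    ∃ (t : MultigradedSubmodule K V) (f : (Fin t.rank → K) →ₗ[K] (Fin s.rank → K)),
      mapFamily ((ofPreorder K (V →₀ ℕ)).free t.deg) f = s.family ∧
      t.family = kerFamily ((ofPreorder K (V →₀ ℕ)).free t.deg) f ∧
      ∀ a, ∀ c ∈ t.family a, ∀ i, t.deg i = a → c i = 0 := by
  obtain ⟨k, b, f, hf, hmin⟩ := exists_minimal_cover s.stable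
  exact ⟨⟨k, b, kerFamily _ f, (stable_free b).ker f, fun a => inf_le_left⟩, f, hf, rfl, hmin⟩

/-- The minimal syzygies of a multigraded submodule. -/
noncomputable def syzygies (s : MultigradedSubmodule K V) : MultigradedSubmodule K V :=
  s.exists_syzygies.choose

/-- The minimal cover of a multigraded submodule, on the spaces of basis vectors. -/
noncomputable def cover (s : MultigradedSubmodule K V) :
    (Fin s.syzygies.rank → K) →ₗ[K] (Fin s.rank → K) :=
  s.exists_syzygies.choose_spec.choose

theorem cover_spec (s : MultigradedSubmodule K V) :
    mapFamily ((ofPreorder K (V →₀ ℕ)).free s.syzygies.deg) s.cover = s.family ∧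
      s.syzygies.family = kerFamily ((ofPreorder K (V →₀ ℕ)).free s.syzygies.deg) s.cover ∧
      ∀ a, ∀ c ∈ s.syzygies.family a, ∀ i, s.syzygies.deg i = a → c i = 0 :=
  s.exists_syzygies.choose_spec.choose_spec

theorem coeffVec_extendScalars_cover_mem (s : MultigradedSubmodule K V)
    (x : Fin s.syzygies.rank → MvPolynomial V K) (a : V →₀ ℕ) :
    coeffVec a (extendScalars V s.cover (mulMonomials K s.syzygies.deg x)) ∈ s.family a := by
  rw [coeffVec_extendScalars, ← s.cover_spec.1]
  exact ⟨_, coeffVec_mulMonomials_mem _ x a, rfl⟩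

/-- The cover takes values in the family of `s`, which lies in the free family; hence its
coordinates are divisible by the monomials of the basis degrees. -/
theorem exists_differential (s : MultigradedSubmodule K V) :
    ∃ D : (Fin s.syzygies.rank → MvPolynomial V K) →ₗ[MvPolynomial V K]
        (Fin s.rank → MvPolynomial V K),
      ∀ x, mulMonomials K s.deg (D x) =
        extendScalars V s.cover (mulMonomials K s.syzygies.deg x) := by
  classical
  choose y hy using fun i => exists_mulMonomials_eq fun a => s.le_free a
    (s.coeffVec_extendScalars_cover_mem (Pi.single i 1) a)
  refine ⟨Fintype.linearCombination _ y, fun x => ?_⟩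
  suffices h : mulMonomials K s.deg ∘ₗ Fintype.linearCombination _ y =
      extendScalars V s.cover ∘ₗ mulMonomials K s.syzygies.deg from LinearMap.congr_fun h x
  refine LinearMap.pi_ext' fun i => LinearMap.ext_ring ?_
  change mulMonomials K s.deg (Fintype.linearCombination _ y (Pi.single i 1)) = _
  rw [Fintype.linearCombination_apply_single, one_smul, hy]
  rfl

/-- The differential of the minimal resolution that covers `s`. -/
noncomputable def differential (s : MultigradedSubmodule K V) :
    (Fin s.syzygies.rank → MvPolynomial V K) →ₗ[MvPolynomial V K] (Fin s.rank → MvPolynomial V K) :=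
  s.exists_differential.choose

theorem mulMonomials_differential (s : MultigradedSubmodule K V)
    (x : Fin s.syzygies.rank → MvPolynomial V K) : mulMonomials K s.deg (s.differential x) =
      extendScalars V s.cover (mulMonomials K s.syzygies.deg x) :=
  s.exists_differential.choose_spec x

theorem mem_range_differential_iff (s : MultigradedSubmodule K V)
    {z : Fin s.rank → MvPolynomial V K} : (∃ x, s.differential x = z) ↔
      ∀ a, coeffVec a (mulMonomials K s.deg z) ∈ s.family a := by
  constructor
  · rintro ⟨x, rfl⟩ a
    rw [mulMonomials_differential]
    exact s.coeffVec_extendScalars_cover_mem x a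
  · intro h
    rw [← s.cover_spec.1] at h
    obtain ⟨y, hy, hyz, -⟩ := exists_extendScalars_eq h
    obtain ⟨x, rfl⟩ := exists_mulMonomials_eq hy
    refine ⟨x, mulMonomials_injective s.deg ?_⟩
    rw [mulMonomials_differential, hyz]

theorem exact_differential (s : MultigradedSubmodule K V) :
    Function.Exact s.syzygies.differential s.differential := by
  intro x
  rw [Set.mem_range, mem_range_differential_iff, s.cover_spec.2.1,
    ← (mulMonomials_injective s.deg).eq_iff, mulMonomials_differential, map_zero]
  constructor
  · intro h a
    refine ⟨coeffVec_mulMonomials_mem _ x a, ?_⟩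
    change s.cover _ = 0
    rw [← coeffVec_extendScalars, h]
    rfl
  · refine fun h => coeffVec_injective fun a => ?_
    rw [coeffVec_extendScalars]
    exact (show s.cover _ = 0 from (h a).2)

theorem differential_mem (s : MultigradedSubmodule K V) (j : ℤ)
    (x : Fin s.syzygies.rank → MvPolynomial V K)
    (hx : x ∈ (gradedSystem K V).free (fun i => ((s.syzygies.deg i).degree : ℤ)) j) :
    s.differential x ∈ (gradedSystem K V).free (fun i => ((s.deg i).degree : ℤ)) j := by
  rw [← mulMonomials_mem_realize_free] at hx ⊢
  rw [mulMonomials_differential]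
  have h : extendScalars V s.cover (mulMonomials K s.syzygies.deg x) ∈ realize s.family j := by
    rw [← s.cover_spec.1, ← mapFamily_extendScalars]
    exact ⟨_, hx, rfl⟩
  exact fun a => ⟨s.le_free a (h a).1, (h a).2⟩

/-- The constant term in coordinate i is the entry at i of a syzygy in the degree of generator i,
which vanishes for a minimal cover. -/
theorem constantCoeff_differential (s : MultigradedSubmodule K V)
    (x : Fin s.syzygies.syzygies.rank → MvPolynomial V K) (i : Fin s.syzygies.rank) :
    constantCoeff (s.syzygies.differential x i) = 0 := by
  have h := (s.syzygies.mem_range_differential_iff (z := s.syzygies.differential x)).1 ⟨x, rfl⟩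
  have := s.cover_spec.2.2 _ _ (h (s.syzygies.deg i + 0)) i (add_zero _).symm
  rwa [coeffVec_mulMonomials_add] at this

/-- The iterated minimal syzygies. -/
noncomputable def iterSyzygies (s : MultigradedSubmodule K V) : ℕ → MultigradedSubmodule K V
  | 0 => s
  | i + 1 => (s.iterSyzygies i).syzygies

theorem resolved_iterSyzygies (s : MultigradedSubmodule K V) {r : ℤ}
    (hr : ∀ i a, (((s.iterSyzygies (i + 1)).deg a).degree : ℤ) ≤ r + i) (n i : ℕ) :
    (ofPreorder K (V →₀ ℕ)).Resolved (degreeLE V) n (r + i) (s.iterSyzygies i).family := by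
  induction n generalizing i with
  | zero => trivial
  | succ n ih =>
    refine ⟨Fin (s.iterSyzygies (i + 1)).rank, inferInstance, (s.iterSyzygies (i + 1)).deg,
      (s.iterSyzygies i).cover, hr i, (s.iterSyzygies i).cover_spec.1, ?_⟩
    have := ih (i + 1)
    rw [show (s.iterSyzygies (i + 1)).family = _ from (s.iterSyzygies i).cover_spec.2.1] at this
    have hi : r + (i : ℤ) + 1 = r + ((i + 1 : ℕ) : ℤ) := by
      push_cast
      ring
    rw [hi]
    exact this

/-- The multigraded submodule of a free module of rank one that is a monomial ideal. -/
noncomputable def ofUpperSet (K : Type u) [Field K] {U : Set (V →₀ ℕ)} (hU : IsUpperSet U) :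
    MultigradedSubmodule K V where
  rank := 1
  deg _ := 0
  family := vectorFamily K U
  stable := (stable_monomialFamily hU).map _
  le_free _ _ _ := mem_free_ofPreorder.2 fun _ _ => zero_le

theorem mem_range_differential_ofUpperSet {U : Set (V →₀ ℕ)} (hU : IsUpperSet U)
    {z : Fin 1 → MvPolynomial V K} : (∃ x, (ofUpperSet K hU).differential x = z) ↔
      z 0 ∈ restrictSupportIdeal (R := K) U hU := by
  refine (mem_range_differential_iff _).trans ?_
  rw [mem_restrictSupportIdeal]
  refine forall_congr' fun a => mem_vectorFamily.trans (imp_congr_left ?_)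
  have := coeffVec_mulMonomials_add (ofUpperSet K hU).deg z (0 : Fin 1) a
  rw [show (ofUpperSet K hU).deg (0 : Fin 1) = 0 from rfl, zero_add] at this
  rw [this]

end MultigradedSubmodule

open MultigradedSubmodule in
/-- A monomial ideal has a minimal graded free resolution that comes from a multigraded one. -/
theorem exists_minimalGradedFreeResolution [Finite V] {U : Set (V →₀ ℕ)} (hU : IsUpperSet U) :
    ∃ F : MinimalGradedFreeResolution K V (restrictSupportIdeal (R := K) U hU) (idealComponent _),
      ∀ r : ℤ, (∀ i a, F.shift i a ≤ r + i) → RegLE K r U := by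
  let s := ofUpperSet K hU
  let t := s.iterSyzygies
  let aug : (Fin (t 1).rank → MvPolynomial V K) →ₗ[MvPolynomial V K]
      restrictSupportIdeal (R := K) U hU :=
    (LinearMap.proj (0 : Fin 1) ∘ₗ (t 0).differential).codRestrict _ fun x =>
      (mem_range_differential_ofUpperSet hU).1 ⟨x, rfl⟩
  have haug : ∀ x, idealToFree _ (aug x) = (t 0).differential x := by
    intro x
    funext i
    rw [show i = (0 : Fin 1) from Subsingleton.elim (α := Fin 1) _ _]
    rfl
  refine ⟨{
    -- The index is shifted because `t 0` is the ideal inside S, and the generators of the ideal are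
    -- the basis degrees of `t 1`.
    rank := fun i => (t (i + 1)).rank
    shift := fun i a => ((t (i + 1)).deg a).degree
    d := fun i => (t (i + 1)).differential
    aug := aug
    d_mem := fun i j x hx => ?_
    aug_mem := fun j x hx => ?_
    aug_surjective := fun y => ?_
    exact_zero := fun x => ?_
    exact_succ := fun i => (t (i + 1)).exact_differential
    minimal := fun i x a => (t i).constantCoeff_differential x a }, fun r hr n => ?_⟩
  · rw [mem_freeComponent_iff] at hx ⊢
    exact (t (i + 1)).differential_mem j x hx
  · rw [mem_freeComponent_iff] at hx
    rw [← idealToFree_mem_free_iff, haug]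
    have := (t 0).differential_mem j x hx
    have h0 : (fun i => (((t 0).deg i).degree : ℤ)) = fun _ => 0 := by
      funext i
      change (((0 : V →₀ ℕ).degree : ℕ) : ℤ) = 0
      simp
    rwa [h0] at this
  · obtain ⟨x, hx⟩ := (mem_range_differential_ofUpperSet hU (K := K) (z := fun _ => (y : MvPolynomial V K))).2 y.2
    exact ⟨x, idealToFree_injective _ ((haug x).trans hx)⟩
  · rw [← (idealToFree_injective _).eq_iff, haug, map_zero]
    exact (t 0).exact_differential x
  · rw [← resolved_vectorFamily_iff hU]
    have := s.resolved_iterSyzygies hr n 0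
    rwa [Nat.cast_zero, add_zero] at this

end Existence

/-! ### The edge ideal and its powers as monomial ideals -/

section MonomialIdeals

variable {K : Type u} {V : Type v} [Field K]

theorem span_monomial_eq_restrictSupportIdeal {T U : Set (V →₀ ℕ)} (hU : IsUpperSet U)
    (h : ∀ a, a ∈ U ↔ ∃ m ∈ T, m ≤ a) :
    Ideal.span ((fun m => monomial m (1 : K)) '' T) = restrictSupportIdeal (R := K) U hU := by
  ext p
  rw [mem_ideal_span_monomial_image, mem_restrictSupportIdeal]
  simp only [h, mem_support_iff]

theorem mem_of_forall_monomial_mem {I : Ideal (MvPolynomial V K)} {p : MvPolynomial V K}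
    (h : ∀ a, coeff a p ≠ 0 → monomial a (coeff a p) ∈ I) : p ∈ I := by
  rw [p.as_sum]
  exact sum_mem fun a ha => h a (mem_support_iff.1 ha)

theorem restrictSupportIdeal_sup {U W : Set (V →₀ ℕ)} (hU : IsUpperSet U) (hW : IsUpperSet W) :
    restrictSupportIdeal (R := K) U hU ⊔ restrictSupportIdeal (R := K) W hW =
      restrictSupportIdeal (R := K) (U ∪ W) (hU.union hW) := by
  classical
  have hmon : ∀ {U : Set (V →₀ ℕ)} (hU : IsUpperSet U) {a} {c : K}, a ∈ U →
      monomial a c ∈ restrictSupportIdeal (R := K) U hU := by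
    intro U hU a c ha
    rw [mem_restrictSupportIdeal]
    intro d hd
    rw [coeff_monomial] at hd
    split_ifs at hd with h
    · exact h ▸ ha
    · exact absurd rfl hd
  refine le_antisymm (sup_le ?_ ?_) fun p hp => ?_
  · intro p hp
    rw [mem_restrictSupportIdeal] at hp ⊢
    exact fun a ha => Or.inl (hp a ha)
  · intro p hp
    rw [mem_restrictSupportIdeal] at hp ⊢
    exact fun a ha => Or.inr (hp a ha)
  · rw [mem_restrictSupportIdeal] at hp
    refine mem_of_forall_monomial_mem fun a ha => ?_
    rcases hp a ha with h | h
    · exact Ideal.mem_sup_left (hmon hU h)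
    · exact Ideal.mem_sup_right (hmon hW h)

variable (K) in
theorem edgeIdeal_eq_span (G : SimpleGraph V) : edgeIdeal K G =
    Ideal.span ((fun m => monomial m (1 : K)) ''
      {m | ∃ v w, G.Adj v w ∧ Finsupp.single v 1 + Finsupp.single w 1 = m}) := by
  rw [edgeIdeal]
  congr 1
  ext f
  constructor
  · rintro ⟨v, w, h, rfl⟩
    exact ⟨_, ⟨v, w, h, rfl⟩, by simp [X, monomial_mul]⟩
  · rintro ⟨_, ⟨v, w, h, rfl⟩, rfl⟩
    exact ⟨v, w, h, by simp [X, monomial_mul]⟩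

variable (K) in
theorem edgeIdeal_eq_restrictSupportIdeal (G : SimpleGraph V) :
    edgeIdeal K G = restrictSupportIdeal (R := K) G.edgeExponents SimpleGraph.isUpperSet_edgeExponents := by
  classical
  rw [edgeIdeal_eq_span]
  refine span_monomial_eq_restrictSupportIdeal _ fun a => ⟨?_, ?_⟩
  · rintro ⟨v, w, h, hv, hw⟩
    refine ⟨_, ⟨v, w, h, rfl⟩, Finsupp.le_def.2 fun z => ?_⟩
    rw [Finsupp.add_apply, Finsupp.single_apply, Finsupp.single_apply]
    split_ifs with h₁ h₂ h₂
    · exact absurd (h₁.trans h₂.symm) h.ne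
    · subst h₁
      omega
    · subst h₂
      omega
    · omega
  · rintro ⟨_, ⟨v, w, h, rfl⟩, hle⟩
    have h₁ := Finsupp.le_def.1 hle v
    have h₂ := Finsupp.le_def.1 hle w
    rw [Finsupp.add_apply, Finsupp.single_eq_same] at h₁ h₂
    exact ⟨v, w, h, by omega, by omega⟩

variable (K) in
theorem edgeIdeal_pow_eq_span (G : SimpleGraph V) (s : ℕ) : edgeIdeal K G ^ s =
    Ideal.span ((fun m => monomial m (1 : K)) '' G.edgeProducts s) := by
  induction s with
  | zero =>
    symm
    rw [pow_zero, Ideal.one_eq_top, Ideal.eq_top_iff_one]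
    exact Ideal.subset_span ⟨0, ⟨0, rfl, by simp, rfl⟩, rfl⟩
  | succ s ih =>
    rw [pow_succ, ih, edgeIdeal_eq_span, Ideal.span_mul_span']
    congr 1
    ext f
    rw [Set.mem_mul]
    constructor
    · rintro ⟨_, ⟨_, ⟨l, rfl, hl, rfl⟩, rfl⟩, _, ⟨_, ⟨v, w, h, rfl⟩, rfl⟩, rfl⟩
      refine ⟨_, ⟨(v, w) ::ₘ l, Multiset.card_cons _ _, ?_, rfl⟩, ?_⟩
      · intro p hp
        rcases Multiset.mem_cons.1 hp with rfl | hp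
        exacts [h, hl p hp]
      · simp [edgeSum_cons, monomial_mul, add_comm]
    · rintro ⟨_, ⟨l, hc, hl, rfl⟩, rfl⟩
      obtain ⟨⟨v, w⟩, l', rfl, hc'⟩ := Multiset.card_eq_succ_iff.1 hc
      refine ⟨_, ⟨_, ⟨l', hc', fun p hp => hl p (Multiset.mem_cons_of_mem hp), rfl⟩, rfl⟩, _,
        ⟨_, ⟨v, w, hl _ (Multiset.mem_cons_self _ _), rfl⟩, rfl⟩, ?_⟩
      simp [edgeSum_cons, monomial_mul, add_comm]

variable (K) in
theorem edgeIdeal_pow_eq_restrictSupportIdeal (G : SimpleGraph V) (s : ℕ) : edgeIdeal K G ^ s =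
    restrictSupportIdeal (R := K) (G.powerExponents s) (SimpleGraph.isUpperSet_powerExponents s) := by
  rw [edgeIdeal_pow_eq_span]
  exact span_monomial_eq_restrictSupportIdeal _ fun a => Iff.rfl

end MonomialIdeals

/-! ### Minimal primes and symbolic powers of the edge ideal -/

section CoverIdeal

variable {K : Type u} {V : Type v} [Field K]

open Classical in
/-- The substitution `x_v ↦ T x_v` for `v ∈ C`. -/
noncomputable def scaleVariables (K : Type u) [Field K] (C : Finset V) :
    MvPolynomial V K →+* Polynomial (MvPolynomial V K) :=
  eval₂Hom (Polynomial.C.comp MvPolynomial.C) fun v =>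
    if v ∈ C then Polynomial.X * Polynomial.C (X v) else Polynomial.C (X v)

variable {C : Finset V}

theorem scaleVariables_monomial (a : V →₀ ℕ) (c : K) :
    scaleVariables K C (monomial a c) =
      Polynomial.X ^ (∑ v ∈ C, a v) * Polynomial.C (monomial a c) := by
  classical
  induction a using Finsupp.induction_linear generalizing c with
  | zero =>
    simp only [Finsupp.coe_zero, Pi.zero_apply, Finset.sum_const_zero, pow_zero, one_mul]
    exact eval₂_C _ _ _
  | add a b ha hb =>
    have h : monomial (a + b) c = monomial a c * monomial b (1 : K) := by
      rw [monomial_mul, mul_one]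
    rw [h, map_mul, ha, hb, Polynomial.C_mul]
    simp only [Finsupp.add_apply, Finset.sum_add_distrib, pow_add]
    ring
  | single v n =>
    rw [← C_mul_X_pow_eq_monomial, map_mul, map_pow]
    simp only [scaleVariables, coe_eval₂Hom, eval₂_C, eval₂_X, Finsupp.single_apply,
      Finset.sum_ite_eq, RingHom.comp_apply, Polynomial.C_mul, Polynomial.C_pow]
    split_ifs
    · ring
    · ring

theorem coeff_scaleVariables (f : MvPolynomial V K) (a : V →₀ ℕ) (k : ℕ) :
    coeff a ((scaleVariables K C f).coeff k) = if ∑ v ∈ C, a v = k then coeff a f else 0 := by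
  classical
  induction f using MvPolynomial.induction_on' with
  | monomial d c =>
    rw [scaleVariables_monomial, Polynomial.coeff_X_pow_mul', coeff_monomial]
    by_cases hd : d = a
    · subst hd
      by_cases hk : ∑ v ∈ C, d v = k
      · simp [hk]
      · rw [if_neg hk]
        split_ifs with h
        · rw [Polynomial.coeff_C, if_neg (by omega), coeff_zero]
        · rw [coeff_zero]
    · rw [if_neg hd, ite_self]
      split_ifs with h
      · rw [Polynomial.coeff_C]
        split_ifs
        · rw [coeff_monomial, if_neg hd]
        · rw [coeff_zero]
      · rw [coeff_zero]
  | add p q hp hq =>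
    rw [map_add, Polynomial.coeff_add, coeff_add, coeff_add, hp, hq]
    split_ifs <;> simp

/-- The degree in the variables of C becomes the order in T, so divisibility by powers of the prime
element T can replace primary decomposition. -/
theorem X_pow_dvd_scaleVariables_iff {t : ℕ} {f : MvPolynomial V K} :
    Polynomial.X ^ t ∣ scaleVariables K C f ↔ ∀ a, coeff a f ≠ 0 → t ≤ ∑ v ∈ C, a v := by
  rw [Polynomial.X_pow_dvd_iff]
  constructor
  · intro h a ha
    by_contra! hlt
    have := congrArg (coeff a) (h _ hlt)
    rw [coeff_scaleVariables, if_pos rfl, coeff_zero] at this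
    exact ha this
  · intro h d hd
    ext a
    rw [coeff_scaleVariables, coeff_zero]
    split_ifs with hs
    · by_contra hne
      have := h a hne
      omega
    · rfl

/-- The prime ideal generated by the variables in `C`. -/
noncomputable def coverIdeal (K : Type u) [Field K] (C : Finset V) : Ideal (MvPolynomial V K) :=
  (Ideal.span {Polynomial.X}).comap (scaleVariables K C)

theorem mem_coverIdeal_iff_dvd {f : MvPolynomial V K} :
    f ∈ coverIdeal K C ↔ Polynomial.X ∣ scaleVariables K C f := by
  rw [coverIdeal, Ideal.mem_comap, Ideal.mem_span_singleton]

theorem mem_coverIdeal_iff {f : MvPolynomial V K} :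
    f ∈ coverIdeal K C ↔ ∀ a, coeff a f ≠ 0 → 1 ≤ ∑ v ∈ C, a v := by
  rw [mem_coverIdeal_iff_dvd, ← X_pow_dvd_scaleVariables_iff, pow_one]

instance isPrime_coverIdeal (C : Finset V) : (coverIdeal K C).IsPrime := by
  have : (Ideal.span {(Polynomial.X : Polynomial (MvPolynomial V K))}).IsPrime :=
    (Ideal.span_singleton_prime Polynomial.X_ne_zero).2 Polynomial.prime_X
  exact Ideal.comap_isPrime _ _

theorem X_mem_coverIdeal_iff {v : V} : X v ∈ coverIdeal K C ↔ v ∈ C := by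
  classical
  rw [mem_coverIdeal_iff]
  have hX : ∀ a : V →₀ ℕ, coeff a (X v : MvPolynomial V K) ≠ 0 ↔ a = Finsupp.single v 1 := by
    intro a
    rw [coeff_X]
    simp [eq_comm]
  simp only [hX, forall_eq, Finsupp.single_apply, Finset.sum_ite_eq]
  split_ifs with h <;> simp [h]

theorem monomial_eq_mul_X {a : V →₀ ℕ} {v : V} (h : a v ≠ 0) (c : K) :
    monomial a c = monomial (a - Finsupp.single v 1) c * X v := by
  rw [X, monomial_mul, mul_one, tsub_add_cancel_of_le]
  rw [Finsupp.single_le_iff]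
  omega

theorem coverIdeal_le {q : Ideal (MvPolynomial V K)} (h : ∀ v ∈ C, X v ∈ q) :
    coverIdeal K C ≤ q := by
  intro f hf
  rw [mem_coverIdeal_iff] at hf
  refine mem_of_forall_monomial_mem fun a ha => ?_
  obtain ⟨v, hv, hvC⟩ := SimpleGraph.sum_pos_iff.1 (hf a ha)
  rw [monomial_eq_mul_X (Finsupp.mem_support_iff.1 hv)]
  exact q.mul_mem_left _ (h v hvC)

variable {G : SimpleGraph V}

theorem edgeIdeal_le_iff {q : Ideal (MvPolynomial V K)} :
    edgeIdeal K G ≤ q ↔ ∀ v w, G.Adj v w → X v * X w ∈ q := by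
  rw [edgeIdeal, Ideal.span_le]
  exact ⟨fun h v w hvw => h ⟨v, w, hvw, rfl⟩, fun h f ⟨v, w, hvw, hf⟩ => hf ▸ h v w hvw⟩

theorem edgeIdeal_le_coverIdeal (hC : G.IsVertexCover ↑C) : edgeIdeal K G ≤ coverIdeal K C := by
  rw [edgeIdeal_le_iff]
  intro v w h
  rcases hC h with h | h
  · exact Ideal.mul_mem_right _ _ (X_mem_coverIdeal_iff.2 h)
  · exact Ideal.mul_mem_left _ _ (X_mem_coverIdeal_iff.2 h)

/-- The variables in a prime over the edge ideal form a vertex cover; a minimal cover among them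
gives a smaller prime over the edge ideal. -/
theorem minimalPrimes_edgeIdeal [Finite V] (p : Ideal (MvPolynomial V K)) :
    p ∈ (edgeIdeal K G).minimalPrimes ↔ ∃ C, G.IsMinimalCover C ∧ p = coverIdeal K C := by
  classical
  cases nonempty_fintype V
  let D : Ideal (MvPolynomial V K) → Finset V := fun q => Finset.univ.filter fun v => X v ∈ q
  have hD : ∀ q, q.IsPrime → edgeIdeal K G ≤ q → G.IsVertexCover ↑(D q) := by
    intro q hq hle v w h
    simp only [D, Finset.coe_filter, Finset.mem_univ, true_and, Set.mem_ofPred_eq]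
    exact hq.mem_or_mem (edgeIdeal_le_iff.1 hle v w h)
  constructor
  · rintro ⟨⟨hp, hle⟩, hmin⟩
    obtain ⟨C, hCD, hC⟩ := SimpleGraph.exists_isMinimalCover_subset (hD p hp hle)
    have hCp : coverIdeal K C ≤ p := coverIdeal_le fun v hv => (Finset.mem_filter.1 (hCD hv)).2
    exact ⟨C, hC, le_antisymm (hmin ⟨inferInstance, edgeIdeal_le_coverIdeal hC.1⟩ hCp) hCp⟩
  · rintro ⟨C, hC, rfl⟩
    refine ⟨⟨inferInstance, edgeIdeal_le_coverIdeal hC.1⟩, fun q hq hqC => coverIdeal_le ?_⟩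
    intro v hv
    have hDC : D q ≤ C := fun w hw => X_mem_coverIdeal_iff.1 (hqC (Finset.mem_filter.1 hw).2)
    exact (Finset.mem_filter.1 (hC.2 (hD q hq.1 hq.2) hDC hv)).2

theorem SimpleGraph.IsMinimalCover.exists_adj (hC : G.IsMinimalCover C) {v : V} (hv : v ∈ C) :
    ∃ w, G.Adj v w ∧ w ∉ C := by
  classical
  have hnot : ¬ G.IsVertexCover ↑(C.erase v) := fun h =>
    Finset.notMem_erase v C (hC.2 h (Finset.erase_subset v C) hv)
  simp only [SimpleGraph.IsVertexCover, not_forall, Finset.mem_coe, Finset.mem_erase, not_or,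
    not_and] at hnot
  obtain ⟨x, y, hxy, hx, hy⟩ := hnot
  by_cases hxv : x = v
  · subst hxv
    exact ⟨y, hxy, hy hxy.ne'⟩
  · have hyv : y = v := by
      by_contra hyv
      rcases hC.1 hxy with h | h
      exacts [hx hxv h, hy hyv h]
    subst hyv
    exact ⟨x, hxy.symm, hx hxv⟩

/-- The symbolic power at one minimal prime is a power of that prime. -/
theorem mem_ker_localization_iff (hC : G.IsMinimalCover C) (t : ℕ) (f : MvPolynomial V K) :
    (∃ u ∉ coverIdeal K C, u * f ∈ edgeIdeal K G ^ t) ↔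
      ∀ a, coeff a f ≠ 0 → t ≤ ∑ v ∈ C, a v := by
  classical
  constructor
  · rintro ⟨u, hu, huf⟩
    rw [← X_pow_dvd_scaleVariables_iff]
    rw [mem_coverIdeal_iff_dvd] at hu
    -- T is prime and does not divide the image of u, so the whole power of T divides the image of
    -- f.
    refine Polynomial.prime_X.pow_dvd_of_dvd_mul_left t hu ?_
    rw [← map_mul, ← Ideal.mem_span_singleton, ← Ideal.span_singleton_pow]
    have h := Ideal.mem_map_of_mem (scaleVariables K C) huf
    rw [Ideal.map_pow] at h
    exact Ideal.pow_right_mono (Ideal.map_le_iff_le_comap.2 (edgeIdeal_le_coverIdeal hC.1)) t h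
  · intro h
    choose! w hw hwC using fun v (hv : v ∈ C) => hC.exists_adj hv
    -- By minimality each v in C has a neighbour outside C. Their product lies outside the prime and
    -- multiplies every variable of C into the edge ideal.
    let u : MvPolynomial V K := ∏ v ∈ C, X (w v)
    have hu : u ∉ coverIdeal K C := by
      intro hmem
      obtain ⟨v, hv, hvm⟩ := (Ideal.IsPrime.prod_mem_iff (hp := isPrime_coverIdeal C)).1 hmem
      exact hwC v hv (X_mem_coverIdeal_iff.1 hvm)
    have huX : ∀ v ∈ C, u * X v ∈ edgeIdeal K G := by
      intro v hv
      have h1 : X v * X (w v) ∈ edgeIdeal K G := edgeIdeal_le_iff.1 le_rfl _ _ (hw v hv)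
      change (∏ z ∈ C, X (w z)) * X v ∈ edgeIdeal K G
      rw [← Finset.mul_prod_erase C _ hv, mul_right_comm, mul_comm (X (w v))]
      exact Ideal.mul_mem_right _ _ h1
    have hmon : ∀ (t : ℕ) (a : V →₀ ℕ) (c : K), t ≤ ∑ v ∈ C, a v →
        u ^ t * monomial a c ∈ edgeIdeal K G ^ t := by
      intro t
      induction t with
      | zero => simp
      | succ t ih =>
        intro a c ha
        obtain ⟨v, hv, hvC⟩ := SimpleGraph.sum_pos_iff.1 (le_trans (Nat.succ_le_succ t.zero_le) ha)
        have hv0 := Finsupp.mem_support_iff.1 hv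
        rw [monomial_eq_mul_X hv0, pow_succ u, mul_mul_mul_comm, pow_succ]
        refine Ideal.mul_mem_mul (ih _ c ?_) (huX v hvC)
        have hsum : ∑ z ∈ C, a z = ∑ z ∈ C, (a - (Finsupp.single v 1 : V →₀ ℕ)) z + 1 := by
          have hle : Finsupp.single v 1 ≤ a := by
            rw [Finsupp.single_le_iff]
            omega
          conv_lhs => rw [← tsub_add_cancel_of_le hle]
          simp only [Finsupp.add_apply, Finset.sum_add_distrib, Finsupp.single_apply,
            Finset.sum_ite_eq, if_pos hvC]
        omega
    refine ⟨u ^ t, fun hmem => hu ((isPrime_coverIdeal C).mem_of_pow_mem t hmem), ?_⟩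
    rw [f.as_sum, Finset.mul_sum]
    exact sum_mem fun a ha => hmon t a _ (h a (mem_support_iff.1 ha))

variable (K) in
theorem symbolicPower_edgeIdeal [Finite V] (G : SimpleGraph V) (t : ℕ) :
    symbolicPower (edgeIdeal K G) t = restrictSupportIdeal (R := K) (G.symbolicExponents t)
      (SimpleGraph.isUpperSet_symbolicExponents t) := by
  ext f
  simp only [symbolicPower, Submodule.mem_iInf, LinearMap.mem_ker, LinearMap.comp_apply]
  have hker : ∀ (p : Ideal (MvPolynomial V K)) [p.IsPrime],
      LocalizedModule.mkLinearMap p.primeCompl (MvPolynomial V K ⧸ edgeIdeal K G ^ t)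
        ((edgeIdeal K G ^ t).mkQ f) = 0 ↔ ∃ u ∉ p, u * f ∈ edgeIdeal K G ^ t := by
    intro p _
    rw [← LinearMap.mem_ker, LocalizedModule.mem_ker_mkLinearMap_iff]
    refine exists_congr fun u => and_congr Iff.rfl ?_
    rw [← map_smul, Submodule.mkQ_apply, Submodule.Quotient.mk_eq_zero, smul_eq_mul]
  rw [mem_restrictSupportIdeal]
  constructor
  · intro h a ha C hC
    have h1 := h (coverIdeal K C) ((minimalPrimes_edgeIdeal _).2 ⟨C, hC, rfl⟩)
    exact (mem_ker_localization_iff hC t f).1 ((hker _).1 h1) a ha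
  · intro h p hp
    obtain ⟨C, hC, rfl⟩ := (minimalPrimes_edgeIdeal p).1 hp
    exact (hker _).2 ((mem_ker_localization_iff hC t f).2 fun a ha => h a ha C hC)

end CoverIdeal

/-! ### The regularity inequality -/

section Regularity

variable {K : Type u} {V : Type v} [Field K]

theorem shift_sub_le_gradedRegularity {M : Type*} [AddCommGroup M] [Module (MvPolynomial V K) M]
    [Module K M] {ℳ : ℤ → Submodule K M} (F : MinimalGradedFreeResolution K V M ℳ) (i : ℕ)
    (a : Fin (F.rank i)) :
    ((((F.shift i a - (i : ℤ) : ℤ)) : ℝ) : EReal) ≤ gradedRegularity K V M ℳ := by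
  refine le_iSup_of_le F (le_iSup_of_le i (le_iSup_of_le (F.shift i a) ?_))
  refine le_iSup_of_le (f := fun _ : F.betti i (F.shift i a) ≠ 0 =>
    ((((F.shift i a - (i : ℤ) : ℤ)) : ℝ) : EReal)) ?_ le_rfl
  have : Nonempty {b : Fin (F.rank i) // F.shift i b = F.shift i a} := ⟨⟨a, rfl⟩⟩
  exact Fintype.card_ne_zero

/-- The edge ideal is zero in degrees below two, so generators of degree at most r < 2 would map to
zero, although an edge makes the ideal nonzero. -/
theorem two_le_of_regLE_edgeExponents {G : SimpleGraph V} {r : ℤ} {v w : V} (h : G.Adj v w)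
    (hr : RegLE K r G.edgeExponents) : 2 ≤ r := by
  classical
  by_contra! hlt
  obtain ⟨ι, _, b, f, hb, hN, -⟩ := hr 1
  have hf : f = 0 := by
    refine LinearMap.pi_ext' fun i => LinearMap.ext_ring ?_
    change f (Pi.single i 1) = 0
    have hmem : f (Pi.single i 1) ∈ monomialFamily K G.edgeExponents (b i) := by
      rw [← hN]
      exact ⟨_, single_mem_free b i, rfl⟩
    rw [mem_monomialFamily] at hmem
    by_contra hne
    obtain ⟨x, y, hxy, hx, hy⟩ := hmem hne
    have hle : Finsupp.single x 1 + Finsupp.single y 1 ≤ b i := by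
      refine Finsupp.le_def.2 fun z => ?_
      rw [Finsupp.add_apply, Finsupp.single_apply, Finsupp.single_apply]
      split_ifs with h₁ h₂ h₂
      · exact absurd (h₁.trans h₂.symm) hxy.ne
      · subst h₁
        omega
      · subst h₂
        omega
      · omega
    have hdeg := Finsupp.degree_mono hle
    rw [map_add, Finsupp.degree_single, Finsupp.degree_single] at hdeg
    have := mem_degreeLE.1 (hb i)
    omega
  have hmem : (1 : K) ∈ monomialFamily K G.edgeExponents
      (Finsupp.single v 1 + Finsupp.single w 1) :=
    mem_monomialFamily.2 fun _ => ⟨v, w, h, by simp, by simp⟩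
  rw [← hN, hf] at hmem
  obtain ⟨c, -, hc⟩ := hmem
  exact zero_ne_one hc

end Regularity

theorem theorem3p6 (K : Type*) [Field K] {V : Type*} [Finite V] (G : SimpleGraph V)
    (s : ℕ) (hs : 1 ≤ s) :
    idealRegularity (symbolicPower (edgeIdeal K G) (s + 1)) ≤
      max (idealRegularity (edgeIdeal K G) + ((2 * s : ℕ) : EReal))
        (idealRegularity (symbolicPower (edgeIdeal K G) (s + 1) ⊔ edgeIdeal K G ^ s)) := by
  rw [symbolicPower_edgeIdeal, edgeIdeal_pow_eq_restrictSupportIdeal, restrictSupportIdeal_sup,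
    edgeIdeal_eq_restrictSupportIdeal]
  refine iSup_le fun F => iSup_le fun i => iSup_le fun j => iSup_le fun hβ => ?_
  obtain ⟨⟨a, rfl⟩⟩ : Nonempty {a : Fin (F.rank i) // F.shift i a = j} :=
    Fintype.card_pos_iff.1 (Nat.pos_of_ne_zero hβ)
  -- Assuming a shift of `F` that exceeds both terms supplies integer bounds at once and avoids any
  -- case distinction on infinite values.
  by_contra! hlt
  rw [max_lt_iff] at hlt
  obtain ⟨X, hX⟩ := exists_minimalGradedFreeResolution (K := K)
    (SimpleGraph.isUpperSet_edgeExponents (G := G))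
  obtain ⟨Y, hY⟩ := exists_minimalGradedFreeResolution (K := K)
    ((SimpleGraph.isUpperSet_symbolicExponents (G := G) (s + 1)).union
      (SimpleGraph.isUpperSet_powerExponents s))
  -- The strict inequality is between integers, hence the additional -1.
  have hXr : RegLE K (F.shift i a - i - 1 - 2 * s) G.edgeExponents := by
    refine hX _ fun k b => ?_
    have h := (add_le_add_left (shift_sub_le_gradedRegularity X k b) ((2 * s : ℕ) : EReal)).trans_lt
      hlt.1
    have h' : X.shift k b - (k : ℤ) + (2 * s : ℕ) < F.shift i a - (i : ℤ) := by
      rw [← EReal.coe_natCast, ← EReal.coe_add, EReal.coe_lt_coe_iff] at h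
      exact_mod_cast h
    push_cast at h'
    omega
  have hYr : RegLE K (F.shift i a - i - 1)
      (G.symbolicExponents (s + 1) ∪ G.powerExponents s) := by
    refine hY _ fun k b => ?_
    have h := (shift_sub_le_gradedRegularity Y k b).trans_lt hlt.2
    have h' : Y.shift k b - (k : ℤ) < F.shift i a - (i : ℤ) := by
      exact_mod_cast h
    omega
  have hJ : RegLE K (F.shift i a - i - 1) (G.symbolicExponents (s + 1)) := by
    by_cases hG : ∃ v w, G.Adj v w
    · obtain ⟨v, w, hvw⟩ := hG
      exact SimpleGraph.regLE_symbolicExponents (two_le_of_regLE_edgeExponents hvw hXr)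
        (by omega) hXr hYr
    -- Without edges the empty set is a minimal cover, over which every sum is zero; the symbolic
    -- power is the zero ideal.
    · have hempty : G.symbolicExponents (s + 1) = ∅ := by
        rw [Set.eq_empty_iff_forall_notMem]
        intro m hm
        have h0 : G.IsMinimalCover ∅ :=
          ⟨fun v w h => absurd ⟨v, w, h⟩ hG, fun _ _ _ => Finset.empty_subset _⟩
        have := hm ∅ h0
        simp at this
      simpa only [hempty] using RegLE.empty
  have := hJ.shift_le F i a
  omega
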